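/- Let $p$ be a prime, $f\ge 1$ an integer and $q=p^f$. Let $C$ be a $[g_q(k,d),k,d]_q$ Griesmer code, that is, a $k$-dimensional linear subspace of $\mathbb{F}_q^n$ with $k\ge 1$ whose nonzero codewords have minimum Hamming weight $d$ and whose length meets the Griesmer bound with equality: $$n=g_q(k,d):=\sum_{i=0}^{k-1}\left\lceil \frac{d}{q^i}\right\rceil .$$ Let $\mathrm{wt}(c)$ denote the Hamming weight of $c$. Then for every integer $e\ge 0$: if $q^e\mid d$, then $p^e\mid \mathrm{wt}(c)$ for all $c\in C$. Equivalently, for every integer $e\ge 0$: if $p^e\mid d$, then $p^{\lfloor e/f\rfloor}\mid \mathrm{wt}(c)$ for all $c\in C$. -/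

import Mathlib

/-- The Griesmer number `g_q(k, d) = ∑_{i=0}^{k-1} ⌈d / q^i⌉`. The quotients are rational and
`⌈·⌉₊` is the ceiling, with values in `ℕ`. -/
noncomputable def griesmerNumber (q k d : ℕ) : ℕ :=
  ∑ i ∈ Finset.range k, ⌈(d : ℚ) / (q : ℚ) ^ i⌉₊

/-- `C` is an `[n, k, d]_q` code, `q = |F|`: a `k`-dimensional linear subspace of `F^n` such that
`d` is the minimum of the Hamming weights of its nonzero codewords (in particular a nonzero
codeword exists). -/
structure IsLinearCode {F : Type*} [Field F] [DecidableEq F] {n : ℕ}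
    (C : Submodule F (Fin n → F)) (k d : ℕ) : Prop where
  finrank_eq : Module.finrank F C = k
  minWeight : IsLeast {w : ℕ | ∃ c ∈ C, c ≠ 0 ∧ hammingNorm c = w} d

/-- `C` is a `[g_q(k, d), k, d]_q` Griesmer code, `q = |F|`: an `[n, k, d]_q` code whose length `n`
meets the Griesmer bound. -/
structure IsGriesmerCode {F : Type*} [Field F] [Fintype F] [DecidableEq F] {n : ℕ}
    (C : Submodule F (Fin n → F)) (k d : ℕ) : Prop extends IsLinearCode C k d where
  length_eq : n = griesmerNumber (Fintype.card F) k d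

/-! Let `V` be the code and `w` its weight function, and induct on `e`. Suppose `e ≥ 1`, `q ^ e ∣ d`
and `w = p ^ (e - 1) * U`; it must be shown that `u = U mod p` is zero. It vanishes at `0` and at
all words of weight `d`, and it is invariant under nonzero scalars.

The function `u` also has low degree. Let `I` be the augmentation ideal of a group algebra. In the
group algebra of the additive group of `F`, of order `p ^ f`, `I ^ N` consists of multiples of `p ^
e` once `N > (e + f - 1) * (p - 1)` (`augIdeal_pow_le`). As `w` is a sum of pullbacks of one
function on `F`, the linear extension of `u` kills `I ^ N` in `F[V]` for such `N`
(`dvd_lext_sum_comp`, `lext_cast_eq_zero_of_dvd`).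

If `e ≤ 2` or `f = 1` (`eq_zero_of_min_weight`), the vanishing descends from `I ^ (m + 1)` to `I ^
m`. Modulo `I ^ (m + 1)`, `I ^ m` is spanned by products of `m` semilinear parts (`slot`) of the
elements `[y] - 1`. Scalar invariance disposes of all types of products except those whose exponent
is a multiple of `p ^ f - 1`; for these, a digit count leaves at most one factor beyond `e * (p -
1)` of each type. Since `q ∣ d`, the words of weight `d` contain many affine lines, and polarizing
along them specializes up to `p - 1` factors of each type to a single such word `c`
(`eq_zero_of_diagonal`). The residual code at `c` is Griesmer with minimum weight `d / q`, so this
can be repeated `e` times (`lext_slotProd_mul_eq_zero`). A last remaining factor is handled because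
minimum weight words span.

If `e ≥ 3` and `f ≥ 2` (`eq_zero_of_min_weight_of_three_le`), induct on the dimension. In dimension
at most `e + 1` the code has constant weight. Otherwise at least `q ^ (e + 1) - 1` nonzero
functionals have kernels on which the code is again Griesmer (`RelGriesmer.exists_hyperplanes`), so
`u` vanishes on these kernels. A second moment bound makes the support of `u` small, while the
Reed-Muller minimum distance makes it large unless `u = 0`. -/

lemma sub_one_mul_geom_sum {q : ℕ} (hq : 0 < q) (m : ℕ) :
    (q - 1) * ∑ i ∈ Finset.range m, q ^ i + 1 = q ^ m := by
  obtain ⟨k, rfl⟩ : ∃ k, q = k + 1 := ⟨q - 1, by omega⟩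
  rw [Nat.add_sub_cancel, mul_comm]
  exact geom_sum_mul_add k m

/-! ### Group algebras and powers of the augmentation ideal. -/

namespace GroupAlg

variable {R G H : Type*} [CommRing R] [AddCommGroup G] [AddCommGroup H]

/-- The basis element of the group algebra `R[G]` at `g`. -/
noncomputable def pt (R : Type*) {G : Type*} [CommRing R] [AddCommGroup G] (g : G) :
    AddMonoidAlgebra R G := AddMonoidAlgebra.single g 1

/-- The element `[g] - 1` of the augmentation ideal. -/
noncomputable def dl (R : Type*) {G : Type*} [CommRing R] [AddCommGroup G] (g : G) :
    AddMonoidAlgebra R G := pt R g - 1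

lemma pt_zero : pt R (0 : G) = 1 := rfl

lemma pt_add (a b : G) : pt R (a + b) = pt R a * pt R b := by
  simp [pt, AddMonoidAlgebra.single_mul_single]

lemma pt_nsmul (n : ℕ) (a : G) : pt R (n • a) = pt R a ^ n := by
  induction n with
  | zero => simp [pt_zero]
  | succ n ih => rw [succ_nsmul, pt_add, ih, pow_succ]

lemma pt_eq (a : G) : pt R a = dl R a + 1 := by simp [dl]

lemma dl_zero : dl R (0 : G) = 0 := by simp [dl, pt_zero]

lemma dl_add (a b : G) : dl R (a + b) = dl R a + dl R b + dl R a * dl R b := by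
  simp only [dl, pt_add]; ring

/-- The augmentation ideal. -/
noncomputable def augIdeal (R G : Type*) [CommRing R] [AddCommGroup G] :
    Ideal (AddMonoidAlgebra R G) := Ideal.span (Set.range (dl R))

lemma dl_mem (a : G) : dl R a ∈ augIdeal R G := Ideal.subset_span ⟨a, rfl⟩

lemma dl_mul_dl_mem (a b : G) : dl R a * dl R b ∈ augIdeal R G ^ 2 := by
  rw [pow_two]; exact Ideal.mul_mem_mul (dl_mem a) (dl_mem b)

lemma alg_induction {P : AddMonoidAlgebra R G → Prop} (r : AddMonoidAlgebra R G)
    (h0 : P 0) (hadd : ∀ x y, P x → P y → P (x + y)) (hpt : ∀ (c : R) (g : G), P (c • pt R g)) :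
    P r := by
  refine AddMonoidAlgebra.induction_linear r h0 hadd ?_
  intro m c
  simpa [pt] using hpt c m

/-- The linear extension of a function on the group to the group algebra. -/
noncomputable def lext (u : G → R) : AddMonoidAlgebra R G →ₗ[R] R :=
  (Finsupp.linearCombination R u).comp (AddMonoidAlgebra.coeffLinearEquiv R).toLinearMap

@[simp] lemma lext_pt (u : G → R) (g : G) : lext u (pt R g) = u g := by
  simp [lext, pt]

lemma lext_sum {ι : Type*} (s : Finset ι) (u : ι → G → R) (r : AddMonoidAlgebra R G) :
    lext (fun g => ∑ i ∈ s, u i g) r = ∑ i ∈ s, lext (u i) r := by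
  induction r using alg_induction with
  | h0 => simp
  | hadd x y hx hy => simp only [map_add, hx, hy, Finset.sum_add_distrib]
  | hpt c g => simp [Finset.mul_sum]

lemma lext_smul (c : R) (u : G → R) (r : AddMonoidAlgebra R G) :
    lext (fun g => c * u g) r = c * lext u r := by
  induction r using alg_induction with
  | h0 => simp
  | hadd x y hx hy => simp only [map_add, hx, hy]; ring
  | hpt a g => simp; ring

/-- The map of group algebras induced by a homomorphism of groups. -/
noncomputable def push (R : Type*) {G H : Type*} [CommRing R] [AddCommGroup G] [AddCommGroup H]
    (φ : G →+ H) : AddMonoidAlgebra R G →ₐ[R] AddMonoidAlgebra R H :=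
  AddMonoidAlgebra.mapDomainAlgHom R R φ

@[simp] lemma push_pt (φ : G →+ H) (g : G) : push R φ (pt R g) = pt R (φ g) := by
  simp [push, pt]

@[simp] lemma push_dl (φ : G →+ H) (g : G) : push R φ (dl R g) = dl R (φ g) := by
  simp [dl]

lemma lext_push (φ : G →+ H) (u : H → R) (r : AddMonoidAlgebra R G) :
    lext u (push R φ r) = lext (u ∘ φ) r := by
  induction r using alg_induction with
  | h0 => simp
  | hadd x y hx hy => simp only [map_add, hx, hy]
  | hpt c g => simp

lemma push_mem_pow (φ : G →+ H) {n : ℕ} {r : AddMonoidAlgebra R G} (hr : r ∈ augIdeal R G ^ n) :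
    push R φ r ∈ augIdeal R H ^ n := by
  have h : (augIdeal R G).map (push R φ) ≤ augIdeal R H := by
    rw [augIdeal, Ideal.map_span, Ideal.span_le]
    rintro _ ⟨_, ⟨g, rfl⟩, rfl⟩
    rw [push_dl]; exact dl_mem _
  have := Ideal.mem_map_of_mem (push R φ) hr
  rw [Ideal.map_pow] at this
  exact Ideal.pow_right_mono h n this

/-- Change of coefficients from the integers. -/
noncomputable def castAlg (R G : Type*) [CommRing R] [AddCommGroup G] :
    AddMonoidAlgebra ℤ G →+* AddMonoidAlgebra R G :=
  AddMonoidAlgebra.mapRingHom G (Int.castRingHom R)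

@[simp] lemma castAlg_pt (g : G) : castAlg R G (pt ℤ g) = pt R g := by
  simp [castAlg, pt]

@[simp] lemma castAlg_dl (g : G) : castAlg R G (dl ℤ g) = dl R g := by
  simp [dl]

lemma lext_castAlg (u : G → ℤ) (r : AddMonoidAlgebra ℤ G) :
    lext (fun g => (u g : R)) (castAlg R G r) = (lext u r : ℤ) := by
  induction r using alg_induction with
  | h0 => simp
  | hadd x y hx hy => simp only [map_add, hx, hy]; push_cast; ring
  | hpt c g =>
    have h : (c : AddMonoidAlgebra R G) * pt R g = (c : R) • pt R g := by
      rw [Algebra.smul_def]; simp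
    rw [map_smul (lext u), lext_pt, zsmul_eq_mul, map_mul, map_intCast, castAlg_pt, h]; simp

/-- A set with property closed under the group operations: `dl g ∈ I` is a subgroup. -/
def dlSubgroup (I : Ideal (AddMonoidAlgebra R G)) : AddSubgroup G where
  carrier := {g | dl R g ∈ I}
  zero_mem' := by simp [dl_zero]
  add_mem' := by
    intro a b ha hb
    simp only [Set.mem_ofPred_eq, dl_add] at *
    exact I.add_mem (I.add_mem ha hb) (I.mul_mem_right _ ha)
  neg_mem' := by
    intro a ha
    simp only [Set.mem_ofPred_eq] at *
    have : dl R (-a) = -(pt R (-a) * dl R a) := by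
      simp only [dl, mul_sub, ← pt_add]; simp [pt_zero]
    rw [this]
    exact I.neg_mem (I.mul_mem_left _ ha)

lemma augIdeal_le_of_closure {T : Set G} (hT : AddSubgroup.closure T = ⊤) :
    augIdeal R G ≤ Ideal.span (dl R '' T) := by
  rw [augIdeal, Ideal.span_le]
  rintro _ ⟨g, rfl⟩
  have : AddSubgroup.closure T ≤ dlSubgroup (Ideal.span (dl R '' T)) := by
    rw [AddSubgroup.closure_le]
    intro t ht
    exact Ideal.subset_span ⟨t, ht, rfl⟩
  rw [hT] at this
  exact this (AddSubgroup.mem_top g)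

/-- Expand `1 = [g] ^ p = (([g] - 1) + 1) ^ p`: the middle binomial terms are multiples of `p * ([g]
- 1)`. -/
lemma dl_pow_prime_dvd {p : ℕ} (hp : p.Prime) {g : G} (hg : p • g = 0) :
    (p : AddMonoidAlgebra R G) * dl R g ∣ dl R g ^ p := by
  obtain ⟨r, hr⟩ := exists_add_pow_prime_eq hp (dl R g) 1
  rw [← pt_eq, ← pt_nsmul, hg, pt_zero, one_pow] at hr
  refine ⟨-r, ?_⟩
  linear_combination -hr

/-- Each further `p - 1` factors are traded for one factor `p`; keeping one `dl R g` lets the trade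
be repeated. -/
lemma dl_pow_dvd {p : ℕ} (hp : p.Prime) {g : G} (hg : p • g = 0) (e j : ℕ)
    (h : e * (p - 1) < j) :
    (p : AddMonoidAlgebra R G) ^ e * dl R g ∣ dl R g ^ j := by
  induction e generalizing j with
  | zero => simpa using dvd_pow_self (dl R g) (show j ≠ 0 by rintro rfl; simp at h)
  | succ e ih =>
    have hp2 := hp.two_le
    rw [add_mul, one_mul] at h
    have h1 : e * (p - 1) < j - (p - 1) := by omega
    have h2 : p ≤ j := by
      generalize e * (p - 1) = m at h; omega
    obtain ⟨r, hr⟩ := ih _ h1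
    obtain ⟨r', hr'⟩ := dl_pow_prime_dvd (R := R) hp hg
    have hj : dl R g ^ j = dl R g ^ (j - (p - 1) - 1) * dl R g ^ p := by
      rw [← pow_add]; congr 1; omega
    have hj2 : dl R g ^ (j - (p - 1)) = dl R g ^ (j - (p - 1) - 1) * dl R g := by
      rw [← pow_succ]; congr 1; omega
    refine ⟨r * r', ?_⟩
    rw [hj, hr', show dl R g ^ (j - (p - 1) - 1) * (p * dl R g * r') =
      p * r' * (dl R g ^ (j - (p - 1) - 1) * dl R g) by ring, ← hj2, hr]
    ring

/-- A pigeonhole over the generators: each one may waste up to `p - 1` factors before its powers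
yield a `p`. The hypothesis is `i > (e + T.card - 1) * (p - 1)` without truncated subtraction. -/
lemma span_dl_pow_le {p : ℕ} (hp : p.Prime) (T : Finset G) (hT : ∀ g ∈ T, p • g = 0) (e i : ℕ)
    (h : (e + T.card) * (p - 1) < i + (p - 1)) :
    Ideal.span (dl R '' (T : Set G)) ^ i ≤ Ideal.span {(p : AddMonoidAlgebra R G) ^ e} := by
  classical
  have hp2 := hp.two_le
  induction T using Finset.induction_on generalizing e i with
  | empty =>
    rcases Nat.eq_zero_or_pos i with rfl | hi
    · have : e = 0 := by
        by_contra he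
        have : 1 * (p - 1) ≤ e * (p - 1) := Nat.mul_le_mul_right _ (by omega)
        simp at h; omega
      subst this; simp
    · rw [Finset.coe_empty, Set.image_empty, Ideal.span_empty, ← Ideal.zero_eq_bot,
        zero_pow hi.ne']
      exact bot_le
  | insert g T hgT ih =>
    rw [Finset.coe_insert, Set.image_insert_eq, Set.insert_eq, Ideal.span_union,
      ← Submodule.add_eq_sup, add_pow]
    refine Finset.sum_induction _ (· ≤ Ideal.span {(p : AddMonoidAlgebra R G) ^ e})
      (fun a b ha hb => sup_le ha hb) bot_le ?_
    intro j hj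
    refine Ideal.mul_le_left.trans ?_
    rw [Finset.mem_range] at hj
    rw [Finset.card_insert_of_notMem hgT] at h
    -- `e2` is the number of factors `p` obtained from `j` copies of the generator `g`.
    obtain ⟨e2, he2, he2'⟩ : ∃ e2, (e2 = 0 ∨ e2 * (p - 1) < j) ∧ j ≤ (e2 + 1) * (p - 1) := by
      rcases Nat.eq_zero_or_pos j with rfl | hj0
      · exact ⟨0, Or.inl rfl, by simp⟩
      · refine ⟨(j - 1) / (p - 1), Or.inr ?_, ?_⟩
        · have := Nat.div_mul_le_self (j - 1) (p - 1); omega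
        · have := Nat.lt_div_mul_add (a := j - 1) (show 0 < p - 1 by omega)
          rw [add_mul]; omega
    have hX : Ideal.span {dl R g} ^ j ≤ Ideal.span {(p : AddMonoidAlgebra R G) ^ e2} := by
      rw [Ideal.span_singleton_pow, Ideal.span_singleton_le_span_singleton]
      rcases he2 with rfl | he2
      · simp
      · exact (Dvd.intro _ rfl).trans (dl_pow_dvd hp (hT g (Finset.mem_insert_self _ _)) e2 j he2)
    rcases le_or_gt e e2 with hle | hlt
    · refine (Ideal.mul_mono_left hX).trans (Ideal.mul_le_left.trans ?_)
      rw [Ideal.span_singleton_le_span_singleton]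
      exact pow_dvd_pow _ hle
    · have := ih (fun g hg => hT g (Finset.mem_insert_of_mem hg)) (e - e2) (i - j) (by
        obtain ⟨a, rfl⟩ := Nat.exists_eq_add_of_lt hlt
        have e1 : e2 + a + 1 - e2 = a + 1 := by omega
        rw [e1]
        have : (e2 + a + 1 + (T.card + 1)) * (p - 1)
          = (a + 1 + T.card) * (p - 1) + (e2 + 1) * (p - 1) := by ring
        omega)
      refine (Ideal.mul_mono hX this).trans ?_
      rw [Ideal.span_singleton_mul_span_singleton, ← pow_add,
        Nat.add_sub_cancel' hlt.le]

end GroupAlg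

/-! ### Divisibility on powers of the augmentation ideal, and reduction modulo `p`. -/

namespace GroupAlg

variable {R G H : Type*} [CommRing R] [AddCommGroup G] [AddCommGroup H]

lemma exists_finset_closure_of_module (p f : ℕ) [Fact p.Prime] [Finite G] [Module (ZMod p) G]
    (hcard : Nat.card G = p ^ f) :
    ∃ T : Finset G, T.card = f ∧ AddSubgroup.closure (T : Set G) = ⊤ := by
  classical
  let b := Module.finBasis (ZMod p) G
  have hf : Module.finrank (ZMod p) G = f := by
    have h := Module.natCard_eq_pow_finrank (K := ZMod p) (V := G)
    rw [hcard, Nat.card_zmod] at h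
    exact (Nat.pow_right_injective (Fact.out : p.Prime).two_le h).symm
  refine ⟨Finset.univ.image b, ?_, ?_⟩
  · rw [Finset.card_image_of_injective _ b.injective]; simp [hf]
  · have h1 := b.span_eq
    rw [eq_top_iff]
    intro x _
    have hx : x ∈ Submodule.span (ZMod p) (Set.range b) := h1 ▸ Submodule.mem_top
    have h2 : Submodule.span (ZMod p) (Set.range b) ≤
        AddSubgroup.toZModSubmodule p (AddSubgroup.closure
          ((Finset.univ.image b : Finset G) : Set G)) := by
      rw [Submodule.span_le]
      rintro _ ⟨i, rfl⟩
      exact AddSubgroup.subset_closure (by simp)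
    exact h2 hx

lemma exists_finset_closure (p f : ℕ) (hp : p.Prime) [Finite G] (hG : ∀ g : G, p • g = 0)
    (hcard : Nat.card G = p ^ f) :
    ∃ T : Finset G, T.card = f ∧ AddSubgroup.closure (T : Set G) = ⊤ :=
  have : Fact p.Prime := ⟨hp⟩
  let _ : Module (ZMod p) G := AddCommGroup.zmodModule hG
  exists_finset_closure_of_module p f hcard

/-- In an elementary abelian `p`-group of order `p ^ f`, high powers of the augmentation ideal
consist of multiples of `p ^ e`. -/
lemma augIdeal_pow_le (p f : ℕ) (hp : p.Prime) [Finite G] (hG : ∀ g : G, p • g = 0)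
    (hcard : Nat.card G = p ^ f) (e N : ℕ) (h : (e + f) * (p - 1) < N + (p - 1)) :
    augIdeal R G ^ N ≤ Ideal.span {(p : AddMonoidAlgebra R G) ^ e} := by
  obtain ⟨T, rfl, hT⟩ := exists_finset_closure p f hp hG hcard
  exact (Ideal.pow_right_mono (augIdeal_le_of_closure hT) N).trans
    (span_dl_pow_le hp T (fun g _ => hG g) e N h)

/-- Integer-valued functions of the form `x ↦ ∑ i, χ (φ i x)`, with `φ i` homomorphisms to a fixed
elementary abelian `p`-group, have values divisible by `p ^ e` on high powers of the augmentation
ideal. -/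
lemma dvd_lext_sum_comp {ι : Type*} (s : Finset ι) (p f : ℕ) (hp : p.Prime) [Finite H]
    (hH : ∀ g : H, p • g = 0) (hcard : Nat.card H = p ^ f) (χ : H → ℤ) (φ : ι → G →+ H)
    (e N : ℕ) (h : (e + f) * (p - 1) < N + (p - 1)) (r : AddMonoidAlgebra ℤ G)
    (hr : r ∈ augIdeal ℤ G ^ N) :
    (p : ℤ) ^ e ∣ lext (fun g => ∑ i ∈ s, χ (φ i g)) r := by
  rw [lext_sum]
  refine Finset.dvd_sum fun i _ => ?_
  have h1 : lext (fun g => χ (φ i g)) r = lext χ (push ℤ (φ i) r) := (lext_push (φ i) χ r).symm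
  rw [h1]
  have h2 := augIdeal_pow_le p f hp hH hcard e N h (push_mem_pow (φ i) hr)
  rw [Ideal.mem_span_singleton] at h2
  obtain ⟨t, ht⟩ := h2
  refine ⟨lext χ t, ?_⟩
  have h3 : (p : AddMonoidAlgebra ℤ H) ^ e * t = ((p : ℤ) ^ e) • t := by
    rw [Algebra.smul_def]; simp
  rw [ht, h3, map_smul, smul_eq_mul]

/-- If `w = c * U` and the values of `w` on `augIdeal ^ N` are divisible by `c * p`, then the
reduction of `U` modulo `p` vanishes on `augIdeal ^ N`. -/
lemma lext_cast_eq_zero_of_dvd {p : ℕ} [CharP R p] {c : ℤ} (hc : c ≠ 0) (U : G → ℤ) (N : ℕ)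
    (hU : ∀ r ∈ augIdeal ℤ G ^ N, c * p ∣ lext (fun g => c * U g) r)
    (r : AddMonoidAlgebra R G) (hr : r ∈ augIdeal R G ^ N) :
    lext (fun g => (U g : R)) r = 0 := by
  have hmap : (augIdeal ℤ G).map (castAlg R G) = augIdeal R G := by
    rw [augIdeal, augIdeal, Ideal.map_span, ← Set.range_comp]
    congr 1
    congr 1
    ext g; simp
  rw [← hmap, ← Ideal.map_pow, Ideal.map] at hr
  -- The ideal generated by the integral elements is already their `R`-linear span, because
  -- multiplication by a group element preserves integrality.
  have hspan : r ∈ Submodule.span R (castAlg R G '' (augIdeal ℤ G ^ N : Ideal _)) := by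
    refine Submodule.span_induction (fun x hx => Submodule.subset_span hx)
      (zero_mem _) (fun x y _ _ hx hy => add_mem hx hy) ?_ hr
    intro a x _ hx
    rw [smul_eq_mul]
    induction a using alg_induction with
    | h0 => rw [zero_mul]; exact zero_mem _
    | hadd a b ha hb => rw [add_mul]; exact add_mem ha hb
    | hpt k g =>
      rw [smul_mul_assoc]
      refine Submodule.smul_mem _ _ ?_
      refine Submodule.span_induction (fun y hy => ?_) ?_ (fun y z _ _ hy hz => ?_)
        (fun k y _ hy => ?_) hx
      · obtain ⟨t, ht, rfl⟩ := hy
        refine Submodule.subset_span ⟨pt ℤ g * t, Ideal.mul_mem_left _ _ ht, ?_⟩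
        rw [map_mul, castAlg_pt]
      · rw [mul_zero]; exact zero_mem _
      · rw [mul_add]; exact add_mem hy hz
      · rw [mul_smul_comm]; exact Submodule.smul_mem _ _ hy
  refine Submodule.span_induction (p := fun r _ => lext (fun g => (U g : R)) r = 0)
    ?_ (map_zero _) (fun x y _ _ hx hy => by rw [map_add, hx, hy, add_zero]) ?_ hspan
  · rintro _ ⟨t, ht, rfl⟩
    rw [lext_castAlg]
    have := hU t ht
    rw [lext_smul] at this
    have h2 := Int.dvd_of_mul_dvd_mul_left hc this
    exact (CharP.intCast_eq_zero_iff R p _).2 h2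
  · intro a x _ hx
    rw [map_smul, hx, smul_zero]

end GroupAlg

/-! ### Functions of bounded degree. -/

namespace GroupAlg

/-- `u` has degree less than `n`: all `n`-fold differences of `u` vanish. -/
def DegLT {G A : Type*} [AddCommGroup G] [AddCommGroup A] : ℕ → (G → A) → Prop
  | 0, u => u = 0
  | n + 1, u => ∀ y, DegLT n (fun x => u (x + y) - u x)

section DegLT

variable {G H A : Type*} [AddCommGroup G] [AddCommGroup H] [AddCommGroup A]

/-- Taking the difference of `u` in direction `y` is dual to multiplication by `dl R y`. -/
lemma degLT_of_lext {R : Type*} [CommRing R] (n : ℕ) (u : G → R)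
    (h : ∀ r ∈ augIdeal R G ^ n, lext u r = 0) : DegLT n u := by
  induction n generalizing u with
  | zero => funext g; rw [← lext_pt u g]; exact h _ (by simp)
  | succ n ih =>
    intro y
    refine ih _ fun r hr => ?_
    have key : lext (fun x => u (x + y) - u x) r = lext u (r * dl R y) := by
      clear hr
      induction r using alg_induction with
      | h0 => simp
      | hadd a b ha hb => rw [add_mul, map_add, map_add, ha, hb]
      | hpt c g =>
        rw [smul_mul_assoc, map_smul, map_smul, lext_pt, dl, mul_sub, ← pt_add, mul_one, map_sub,
          lext_pt, lext_pt]
    rw [key]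
    exact h _ (by rw [pow_succ]; exact Ideal.mul_mem_mul hr (dl_mem y))

lemma DegLT.comp_affine {n : ℕ} {u : G → A} (h : DegLT n u) (v : G) (φ : H →+ G) :
    DegLT n (fun x => u (v + φ x)) := by
  induction n generalizing u with
  | zero => have h' : u = 0 := h; subst h'; rfl
  | succ n ih =>
    intro y
    have := ih (h (φ y))
    simpa [add_assoc] using this

end DegLT

section Line

variable {F : Type*} [Field F] {p : ℕ}

lemma fwdDiff_iter_eq_zero {z : ℕ} {φ : ZMod p → F} (h : DegLT z φ) (k : ℕ) (hk : z ≤ k) :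
    (fwdDiff (1 : ZMod p))^[k] φ = 0 := by
  induction k generalizing z φ with
  | zero =>
    obtain rfl : z = 0 := by omega
    exact h
  | succ k ih =>
    cases z with
    | zero =>
      have h' : φ = 0 := h
      rw [Function.iterate_succ_apply]
      refine ih (z := 0) ?_ (Nat.zero_le _)
      subst h'
      change fwdDiff (1 : ZMod p) (0 : ZMod p → F) = 0
      funext x; simp [fwdDiff]
    | succ z =>
      rw [Function.iterate_succ_apply]
      exact ih (h 1) (by omega)

variable [Fact p.Prime] [CharP F p]

/-- A function on `ZMod p` of degree less than `z` with `z` zeros vanishes. -/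
lemma DegLT.eq_zero_of_card {φ : ZMod p → F} (Z : Finset (ZMod p)) (h : DegLT Z.card φ)
    (hZ : ∀ i ∈ Z, φ i = 0) : φ = 0 := by
  set z := Z.card with hz
  have hzp : z ≤ p := by
    have := Finset.card_le_univ Z
    rwa [ZMod.card] at this
  let c : ℕ → F := fun k => ((fwdDiff (1 : ZMod p))^[k] φ) 0
  -- Newton's forward difference formula at `0`. Only `k < z ≤ p` occur, so the factorials are
  -- invertible in `F`.
  let P : Polynomial F := ∑ k ∈ Finset.range z, Polynomial.C (c k / (k.factorial : F)) *
    descPochhammer F k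
  have hval : ∀ n : ℕ, φ n = P.eval (n : F) := by
    intro n
    have h1 := shift_eq_sum_fwdDiff_iter (1 : ZMod p) φ n 0
    rw [zero_add, nsmul_one] at h1
    rw [h1, Polynomial.eval_finsetSum]
    have h2 : ∀ k, n.choose k • c k =
        if k < z then (Polynomial.C (c k / (k.factorial : F)) * descPochhammer F k).eval (n : F)
          else 0 := by
      intro k
      split_ifs with hk
      · have hne : (k.factorial : F) ≠ 0 := by
          rw [Ne, CharP.cast_eq_zero_iff F p, (Fact.out : p.Prime).dvd_factorial]; omega
        rw [Polynomial.eval_mul, Polynomial.eval_C, descPochhammer_eval_eq_descFactorial,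
          Nat.descFactorial_eq_factorial_mul_choose]
        push_cast
        field_simp
        simp [mul_comm]
      · have : c k = 0 := by
          simp only [c]; rw [fwdDiff_iter_eq_zero h k (by omega)]; rfl
        rw [this, smul_zero]
    calc ∑ k ∈ Finset.range (n + 1), n.choose k • ((fwdDiff (1 : ZMod p))^[k] φ) 0
        = ∑ k ∈ Finset.range (n + 1 + z), n.choose k • c k := by
          refine Finset.sum_subset (by intro x; simp; omega) ?_
          intro k _ hk
          rw [Nat.choose_eq_zero_of_lt (by simpa using hk), zero_smul]
      _ = ∑ k ∈ Finset.range (n + 1 + z), if k < z then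
          (Polynomial.C (c k / (k.factorial : F)) * descPochhammer F k).eval (n : F) else 0 :=
          Finset.sum_congr rfl fun k _ => h2 k
      _ = _ := by
          rw [← Finset.sum_filter]
          refine Finset.sum_congr ?_ fun _ _ => rfl
          ext k; simp; omega
  have hφ : ∀ i : ZMod p, φ i = P.eval (i.val : F) := fun i => by
    rw [← hval, ZMod.natCast_zmod_val]
  have hP : P = 0 := by
    by_contra hP
    have hdeg : P.degree < z := by
      refine (Polynomial.degree_sum_le _ _).trans_lt ?_
      rw [Finset.sup_lt_iff (by exact_mod_cast WithBot.bot_lt_coe z)]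
      intro k hk
      have h1 : (descPochhammer F k).natDegree = k := descPochhammer_natDegree F k
      have h2 := Polynomial.natDegree_C_mul_le (c k / (k.factorial : F)) (descPochhammer F k)
      have h3 := Finset.mem_range.1 hk
      refine (Polynomial.degree_le_natDegree).trans_lt ?_
      exact_mod_cast (by omega : _ < z)
    classical
    have hinj : Function.Injective (fun i : ZMod p => (i.val : F)) := by
      intro i j hij
      have h1 := (CharP.natCast_eq_natCast F p).1 hij
      have hi := ZMod.val_lt i
      have hj := ZMod.val_lt j
      exact ZMod.val_injective p (Nat.ModEq.eq_of_lt_of_lt h1 hi hj)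
    have hsub : (Z.image fun i : ZMod p => (i.val : F)).val ⊆ P.roots := by
      intro x hx
      simp only [Finset.mem_val, Finset.mem_image] at hx
      obtain ⟨i, hi, rfl⟩ := hx
      rw [Polynomial.mem_roots hP, Polynomial.IsRoot, ← hφ, hZ i hi]
    have := Polynomial.card_le_degree_of_subset_roots hsub
    rw [Finset.card_image_of_injective _ hinj] at this
    have h2 := (Polynomial.natDegree_lt_iff_degree_lt hP).2 hdeg
    omega
  funext i; rw [hφ, hP]; simp

end Line

/-! ### The minimum distance of Reed-Muller codes over the prime field. -/

section ReedMuller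

variable {F : Type*} [Field F] {p : ℕ} [Fact p.Prime] [CharP F p]

/-- The analogue of dividing by `∏ a ∈ Z, (x₀ - a)`: every slice loses `Z.card` degrees. After
differencing in the other coordinates, the claim reduces to functions on lines in the direction of
`x₀`. -/
lemma DegLT.slice {m n : ℕ} {u : (Fin (m + 1) → ZMod p) → F} (Z : Finset (ZMod p))
    (h : DegLT (n + Z.card) u) (hZ : ∀ i ∈ Z, ∀ x : Fin m → ZMod p, u (Fin.cons i x) = 0)
    (i : ZMod p) : DegLT n (fun x : Fin m → ZMod p => u (Fin.cons i x)) := by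
  have hcons : ∀ (a b : ZMod p) (x y : Fin m → ZMod p),
      (Fin.cons a x + Fin.cons b y : Fin (m + 1) → ZMod p) = Fin.cons (a + b) (x + y) := by
    intro a b x y; funext j; refine Fin.cases ?_ (fun j => ?_) j <;> simp
  induction n generalizing u with
  | zero =>
    funext x
    rw [zero_add] at h
    let φ : ZMod p →+ (Fin (m + 1) → ZMod p) :=
      { toFun := fun a => Fin.cons a 0
        map_zero' := by funext j; refine Fin.cases ?_ (fun j => ?_) j <;> simp
        map_add' := by intro a b; rw [hcons]; simp }
    have h1 := h.comp_affine (Fin.cons 0 x) φ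
    have h2 := DegLT.eq_zero_of_card Z h1 (by
      intro a ha
      change u (Fin.cons 0 x + Fin.cons a 0) = 0
      rw [hcons, zero_add, add_zero]; exact hZ a ha x)
    have h3 := congrFun h2 i
    change u (Fin.cons 0 x + Fin.cons i 0) = 0 at h3
    rwa [hcons, zero_add, add_zero] at h3
  | succ n ih =>
    intro y
    have h1 : DegLT (n + Z.card) (fun x => u (x + Fin.cons 0 y) - u x) := by
      rw [Nat.succ_add_eq_add_succ] at h
      exact h _
    have := ih h1 (by
      intro a ha x
      rw [hcons, add_zero, hZ a ha, hZ a ha, sub_zero])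
    simpa [hcons] using this

open Classical in
-- In degree at most `a * (p - 1) + b` there are at least `(p - b) * p ^ (m - a - 1)` nonzeros.
-- Slice by the first coordinate: if `z` slices vanish, the other `p - z` each have degree lower by
-- `z`, and induction applies to them.
lemma reedMuller_pi (m : ℕ) (u : (Fin m → ZMod p) → F) (a b : ℕ) (hb : b ≤ p - 1)
    (h : DegLT (a * (p - 1) + b + 1) u) (hu : u ≠ 0) :
    (p - b) * p ^ m ≤ p ^ (a + 1) * (Finset.univ.filter fun x => u x ≠ 0).card := by
  have hp2 : 2 ≤ p := (Fact.out : p.Prime).two_le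
  induction m generalizing a b with
  | zero =>
    have h1 : 1 ≤ (Finset.univ.filter fun x => u x ≠ 0).card := by
      obtain ⟨x, hx⟩ := Function.ne_iff.1 hu
      exact Finset.card_pos.2 ⟨x, Finset.mem_filter.2 ⟨Finset.mem_univ _, hx⟩⟩
    calc (p - b) * p ^ 0 ≤ p ^ 1 := by simp
      _ ≤ p ^ (a + 1) := Nat.pow_le_pow_right (by omega) (by omega)
      _ ≤ _ := Nat.le_mul_of_pos_right _ h1
  | succ m ih =>
    let v : ZMod p → (Fin m → ZMod p) → F := fun i x => u (Fin.cons i x)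
    let Z : Finset (ZMod p) := Finset.univ.filter fun i => v i = 0
    have hcard : (Finset.univ.filter fun x => u x ≠ 0).card =
        ∑ i, (Finset.univ.filter fun x => v i x ≠ 0).card := by
      simp only [Finset.card_filter]
      rw [← (Fin.consEquiv (fun _ : Fin (m + 1) => ZMod p)).sum_comp, Fintype.sum_prod_type]
      rfl
    have hcard2 : ∀ N c : ℕ, (∀ i, v i ≠ 0 → N ≤ c * (Finset.univ.filter fun x => v i x ≠ 0).card) →
        (p - Z.card) * N ≤ c * (Finset.univ.filter fun x => u x ≠ 0).card := by
      intro N c hN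
      rw [hcard, Finset.mul_sum]
      have h1 : (Zᶜ).card = p - Z.card := by rw [Finset.card_compl, ZMod.card]
      rw [← h1, ← smul_eq_mul, ← Finset.sum_const]
      refine (Finset.sum_le_sum fun i hi => hN i (by simpa [Z] using hi)).trans ?_
      exact Finset.sum_le_sum_of_subset (Finset.subset_univ _)
    have hslice : ∀ n, n + Z.card = a * (p - 1) + b + 1 → ∀ i, DegLT n (v i) := by
      intro n hn i
      refine DegLT.slice Z (hn ▸ h) ?_ i
      intro j hj x
      exact congrFun (by simpa [Z] using hj : v j = 0) x
    obtain ⟨i0, hi0⟩ : ∃ i, v i ≠ 0 := by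
      by_contra hcon
      push Not at hcon
      apply hu
      funext x
      have := congrFun (hcon (x 0)) (Fin.tail x)
      simpa [v] using this
    have hZp : Z.card < p := by
      have : Z.card < Fintype.card (ZMod p) := by
        refine Finset.card_lt_univ_of_notMem (x := i0) ?_
        simpa [Z] using hi0
      rwa [ZMod.card] at this
    have hZD : Z.card ≤ a * (p - 1) + b := by
      by_contra hcon
      have hz : DegLT (a * (p - 1) + b + 1) u := h
      -- Exactly as many vanishing slices as the degree bound would force every slice to vanish.
      obtain ⟨Z', hZ'Z, hZ'⟩ := Finset.exists_subset_card_eq (s := Z) (n := a * (p - 1) + b + 1)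
        (by omega)
      have : DegLT 0 (v i0) := by
        refine DegLT.slice Z' (by rw [zero_add, hZ']; exact h) ?_ i0
        intro j hj x
        exact congrFun (by simpa [Z] using hZ'Z hj : v j = 0) x
      exact hi0 this
    rcases le_or_gt Z.card b with hzb | hzb
    · have := hcard2 ((p - (b - Z.card)) * p ^ m) (p ^ (a + 1)) (fun i hi =>
        ih (v i) a (b - Z.card) (by omega) (hslice _ (by omega) i) hi)
      refine le_trans ?_ this
      obtain ⟨t, rfl⟩ := Nat.exists_eq_add_of_le hzb
      obtain ⟨s, hs⟩ : ∃ s, p = Z.card + t + s := ⟨p - (Z.card + t), by omega⟩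
      have e1 : p - (Z.card + t) = s := by omega
      have e2 : p - (Z.card + t - Z.card) = Z.card + s := by omega
      have e3 : p - Z.card = t + s := by omega
      rw [e1, e2, e3, pow_succ, show s * (p ^ m * p) = (s * p) * p ^ m by ring,
        show (t + s) * ((Z.card + s) * p ^ m) = ((t + s) * (Z.card + s)) * p ^ m by ring]
      refine Nat.mul_le_mul_right _ ?_
      nlinarith
    -- When more than `b` slices vanish, `p - 1` is borrowed from the term `a * (p - 1)`.
    · obtain ⟨a, rfl⟩ : ∃ a', a = a' + 1 := by
        refine ⟨a - 1, ?_⟩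
        rcases Nat.eq_zero_or_pos a with rfl | ha
        · omega
        · omega
      rw [add_mul, one_mul] at hZD hslice
      have := hcard2 ((p - (b + (p - 1) - Z.card)) * p ^ m) (p ^ (a + 1)) (fun i hi =>
        ih (v i) a (b + (p - 1) - Z.card) (by omega) (hslice _ (by omega) i) hi)
      rw [pow_succ p (a + 1), mul_comm _ p, mul_assoc]
      refine le_trans ?_ (Nat.mul_le_mul_left p this)
      obtain ⟨t, ht⟩ := Nat.exists_eq_add_of_lt hzb
      obtain ⟨s, hs⟩ : ∃ s, p = Z.card + 1 + s := ⟨p - (Z.card + 1), by omega⟩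
      have e1 : p - b = s + t + 2 := by omega
      have e2 : p - (b + (p - 1) - Z.card) = t + 2 := by omega
      have e3 : p - Z.card = s + 1 := by omega
      rw [e1, e2, e3, pow_succ, show (s + t + 2) * (p ^ m * p) = p * ((s + t + 2) * p ^ m) by ring,
        show (s + 1) * ((t + 2) * p ^ m) = ((s + 1) * (t + 2)) * p ^ m by ring]
      refine Nat.mul_le_mul_left _ (Nat.mul_le_mul_right _ ?_)
      nlinarith

open Classical in
lemma reedMuller_of_module {G : Type*} [AddCommGroup G] [Fintype G] [Module (ZMod p) G]
    (u : G → F) (a : ℕ) (h : DegLT (a * (p - 1) + 1) u) (hu : u ≠ 0) :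
    Fintype.card G ≤ p ^ a * (Finset.univ.filter fun x => u x ≠ 0).card := by
  have hp2 : 2 ≤ p := (Fact.out : p.Prime).two_le
  let b := Module.finBasis (ZMod p) G
  let m := Module.finrank (ZMod p) G
  let ψ : (Fin m → ZMod p) ≃ₗ[ZMod p] G := b.equivFun.symm
  have h1 := h.comp_affine 0 (ψ.toLinearMap.toAddMonoidHom)
  have h2 := reedMuller_pi m (fun x => u (0 + ψ x)) a 0 (by omega) h1 (by
    intro hcon
    apply hu
    funext g
    have := congrFun hcon (ψ.symm g)
    simpa using this)
  have h3 : (Finset.univ.filter fun x => u (0 + ψ x) ≠ 0).card =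
      (Finset.univ.filter fun x => u x ≠ 0).card := by
    simp only [Finset.card_filter, zero_add]
    exact ψ.toEquiv.sum_comp (fun x => if u x ≠ 0 then 1 else 0)
  have h4 : Fintype.card G = p ^ m := by
    rw [← Fintype.card_congr ψ.toEquiv]; simp [ZMod.card]
  rw [h3, pow_succ, mul_comm _ p, mul_assoc, Nat.sub_zero] at h2
  rw [h4]
  exact Nat.le_of_mul_le_mul_left h2 (by omega)

open Classical in
/-- The minimum weight of generalized Reed-Muller codes over the prime field, for orders that are
multiples of `p - 1`. -/
lemma reedMuller {G : Type*} [AddCommGroup G] [Fintype G] (hG : ∀ g : G, p • g = 0)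
    (u : G → F) (a : ℕ) (h : DegLT (a * (p - 1) + 1) u) (hu : u ≠ 0) :
    Fintype.card G ≤ p ^ a * (Finset.univ.filter fun x => u x ≠ 0).card :=
  let _ : Module (ZMod p) G := AddCommGroup.zmodModule hG
  reedMuller_of_module u a h hu

end ReedMuller

end GroupAlg

/-! ### Leading forms and the semilinear parts of `[y] - 1`. -/

namespace GroupAlg

section Cong

variable {R : Type*} [CommRing R]

/-- `a` and `b` lie in `J ^ n` and have the same leading form there. -/
def LeadEq (J : Ideal R) (n : ℕ) (a b : R) : Prop := a ∈ J ^ n ∧ b ∈ J ^ n ∧ a - b ∈ J ^ (n + 1)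

lemma LeadEq.mul {J : Ideal R} {m n : ℕ} {a b c d : R} (h : LeadEq J m a b) (h' : LeadEq J n c d) :
    LeadEq J (m + n) (a * c) (b * d) := by
  refine ⟨?_, ?_, ?_⟩
  · rw [pow_add]; exact Ideal.mul_mem_mul h.1 h'.1
  · rw [pow_add]; exact Ideal.mul_mem_mul h.2.1 h'.2.1
  · rw [show a * c - b * d = a * (c - d) + (a - b) * d by ring]
    refine Ideal.add_mem _ ?_ ?_
    · rw [add_assoc, pow_add]; exact Ideal.mul_mem_mul h.1 h'.2.2
    · rw [add_right_comm, pow_add]; exact Ideal.mul_mem_mul h.2.2 h'.2.1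

lemma LeadEq.pow {J : Ideal R} {a b : R} (h : LeadEq J 1 a b) (n : ℕ) :
    LeadEq J n (a ^ n) (b ^ n) := by
  induction n with
  | zero => simp [LeadEq]
  | succ n ih => rw [pow_succ, pow_succ]; exact ih.mul h

lemma LeadEq.prod {ι : Type*} {J : Ideal R} (s : Finset ι) (n : ι → ℕ) (a b : ι → R)
    (h : ∀ i ∈ s, LeadEq J (n i) (a i) (b i)) :
    LeadEq J (∑ i ∈ s, n i) (∏ i ∈ s, a i) (∏ i ∈ s, b i) := by
  classical
  induction s using Finset.induction_on with
  | empty => simp [LeadEq]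
  | insert i s hi ih =>
    rw [Finset.sum_insert hi, Finset.prod_insert hi, Finset.prod_insert hi]
    exact (h i (Finset.mem_insert_self _ _)).mul
      (ih fun k hk => h k (Finset.mem_insert_of_mem hk))

lemma LeadEq.refl {J : Ideal R} {n : ℕ} {a : R} (h : a ∈ J ^ n) : LeadEq J n a a :=
  ⟨h, h, by simp⟩

lemma coeff_one_pow' (P : Polynomial R) (n : ℕ) :
    (P ^ n).coeff 1 = n * P.coeff 0 ^ (n - 1) * P.coeff 1 := by
  induction n with
  | zero => simp [Polynomial.coeff_one]
  | succ n ih =>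
    rw [pow_succ, Polynomial.mul_coeff_one, ih, Polynomial.coeff_zero_eq_eval_zero,
      Polynomial.eval_pow]
    rcases Nat.eq_zero_or_pos n with rfl | hn
    · simp
    · obtain ⟨k, rfl⟩ : ∃ k, n = k + 1 := ⟨n - 1, by omega⟩
      simp only [Nat.add_sub_cancel]
      rw [← Polynomial.coeff_zero_eq_eval_zero]
      push_cast
      ring

lemma coeff_one_prod_eq_zero {ι : Type*} (s : Finset ι) (P : ι → Polynomial R)
    (h : ∀ i ∈ s, (P i).coeff 1 = 0) : (∏ i ∈ s, P i).coeff 1 = 0 := by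
  refine Finset.prod_induction _ (fun P : Polynomial R => P.coeff 1 = 0) ?_ (by simp [Polynomial.coeff_one]) h
  intro a b ha hb
  rw [Polynomial.mul_coeff_one, ha, hb]; simp

end Cong

section Slot

variable {F : Type*} [Field F] [Fintype F] [DecidableEq F] {V : Type*} [AddCommGroup V] [Module F V]

/-- The `p ^ j`-semilinear part of `y ↦ [y] - 1`. -/
noncomputable def slot (F : Type*) [Field F] [Fintype F] [DecidableEq F] {V : Type*} [AddCommGroup V]
    [Module F V] (p : ℕ) (y : V) (j : ℕ) : AddMonoidAlgebra F V :=
  ∑ c : Fˣ, ((c : F)⁻¹ ^ p ^ j) • dl F ((c : F) • y)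

variable (p : ℕ)

omit [Fintype F] [DecidableEq F] [Module F V] in
lemma smul_mem_ideal {I : Ideal (AddMonoidAlgebra F V)} (c : F) {r : AddMonoidAlgebra F V}
    (h : r ∈ I) : c • r ∈ I := by
  rw [Algebra.smul_def]; exact I.mul_mem_left _ h

lemma slot_mem (y : V) (j : ℕ) : slot F p y j ∈ augIdeal F V :=
  Ideal.sum_mem _ fun _ _ => smul_mem_ideal _ (dl_mem _)

lemma slot_smul [hp : Fact p.Prime] (a : F) (y : V) (j : ℕ) :
    slot F p (a • y) j = (a ^ p ^ j) • slot F p y j := by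
  rcases eq_or_ne a 0 with rfl | ha
  · simp [slot, dl_zero, zero_pow (pow_ne_zero j hp.out.ne_zero)]
  · rw [slot, slot, Finset.smul_sum]
    refine Fintype.sum_equiv (Equiv.mulRight (Units.mk0 a ha)) _ _ fun c => ?_
    simp only [Equiv.coe_mulRight, Units.val_mul, Units.val_mk0, smul_smul, ← mul_pow]
    congr 2
    field_simp

lemma slot_add (y z : V) (j : ℕ) :
    slot F p (y + z) j - (slot F p y j + slot F p z j) ∈ augIdeal F V ^ 2 := by
  rw [slot, slot, slot, ← Finset.sum_add_distrib, ← Finset.sum_sub_distrib]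
  refine Ideal.sum_mem _ fun c _ => ?_
  rw [← smul_add, ← smul_sub]
  refine smul_mem_ideal _ ?_
  rw [smul_add, dl_add, add_sub_cancel_left]
  exact dl_mul_dl_mem _ _

/-- In characteristic `p` the `p`-th power is additive, and `([z] - 1) ^ p = [p • z] - 1 = 0`. -/
lemma slot_pow [hp : Fact p.Prime] [CharP F p] (y : V) (j : ℕ) : slot F p y j ^ p = 0 := by
  have : CharP (AddMonoidAlgebra F V) p :=
    charP_of_injective_algebraMap (algebraMap F (AddMonoidAlgebra F V)).injective p
  rw [slot, sum_pow_char]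
  refine Finset.sum_eq_zero fun c _ => ?_
  have h0 : p • ((c : F) • y) = 0 := by
    rw [← Nat.cast_smul_eq_nsmul F, CharP.cast_eq_zero, zero_smul]
  have : dl F ((c : F) • y) ^ p = 0 := by
    rw [dl, sub_pow_char, one_pow, ← pt_nsmul, h0, pt_zero, sub_self]
  rw [_root_.smul_pow, this, smul_zero]

omit [Fintype F] [DecidableEq F] in
lemma dl_natCast_smul (n : ℕ) (z : V) :
    dl F ((n : F) • z) - (n : F) • dl F z ∈ augIdeal F V ^ 2 := by
  induction n with
  | zero => simp [dl_zero]
  | succ n ih =>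
    rw [Nat.cast_succ, add_smul, add_smul, one_smul, one_smul, dl_add]
    rw [show dl F ((n : F) • z) + dl F z + dl F ((n : F) • z) * dl F z -
      ((n : F) • dl F z + dl F z) = (dl F ((n : F) • z) - (n : F) • dl F z) +
        dl F ((n : F) • z) * dl F z by ring]
    exact Ideal.add_mem _ ih (dl_mul_dl_mem _ _)

omit [Fintype F] [DecidableEq F] [Module F V] in
lemma dl_sum {ι : Type*} (s : Finset ι) (z : ι → V) :
    dl F (∑ i ∈ s, z i) - ∑ i ∈ s, dl F (z i) ∈ augIdeal F V ^ 2 := by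
  classical
  induction s using Finset.induction_on with
  | empty => simp [dl_zero]
  | insert i s hi ih =>
    rw [Finset.sum_insert hi, Finset.sum_insert hi, dl_add]
    rw [show dl F (z i) + dl F (∑ i ∈ s, z i) + dl F (z i) * dl F (∑ i ∈ s, z i) -
      (dl F (z i) + ∑ i ∈ s, dl F (z i)) = (dl F (∑ i ∈ s, z i) - ∑ i ∈ s, dl F (z i)) +
        dl F (z i) * dl F (∑ i ∈ s, z i) by ring]
    exact Ideal.add_mem _ ih (dl_mul_dl_mem _ _)

omit [DecidableEq F] in
-- The sum is the trace of `x` to the prime field.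
lemma exists_natCast_eq_sum_frobenius [hp : Fact p.Prime] [CharP F p] {f : ℕ}
    (hq : Fintype.card F = p ^ f) (x : F) :
    ∃ n : ℕ, ∑ j ∈ Finset.range f, x ^ p ^ j = n := by
  let _ : Algebra (ZMod p) F := ZMod.algebra F p
  have hf : Module.finrank (ZMod p) F = f := by
    have h := Module.natCard_eq_pow_finrank (K := ZMod p) (V := F)
    rw [Nat.card_eq_fintype_card, hq, Nat.card_zmod] at h
    exact (Nat.pow_right_injective hp.out.two_le h).symm
  have h := FiniteField.algebraMap_trace_eq_sum_pow (ZMod p) F x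
  rw [hf, Nat.card_zmod] at h
  refine ⟨(Algebra.trace (ZMod p) F x).val, ?_⟩
  rw [← h]
  conv_lhs => rw [← ZMod.natCast_zmod_val (Algebra.trace (ZMod p) F x)]
  rw [map_natCast]

/-- After inverting `c`, the `j`-th part is the power sum of exponent `p ^ j - 1` over the units,
which is nonzero only for `j = 0`. -/
lemma sum_units_frobenius [hp : Fact p.Prime] {f : ℕ} (hf : 0 < f)
    (hq : Fintype.card F = p ^ f) :
    ∑ c : Fˣ, (∑ j ∈ Finset.range f, ((c : F)⁻¹) ^ p ^ j) * (c : F) = -1 := by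
  classical
  have hp2 := hp.out.two_le
  have h1 : ∀ j ∈ Finset.range f, ∑ c : Fˣ, ((c : F)⁻¹) ^ p ^ j * (c : F) =
      if j = 0 then -1 else 0 := by
    intro j hj
    have h2 : ∑ c : Fˣ, ((c : F)⁻¹) ^ p ^ j * (c : F) = ∑ c : Fˣ, (c : F) ^ (p ^ j - 1) := by
      refine Fintype.sum_equiv (Equiv.inv Fˣ) _ _ fun c => ?_
      have hpos : 0 < p ^ j := by positivity
      obtain ⟨k, hk⟩ : ∃ k, p ^ j = k + 1 := ⟨p ^ j - 1, by omega⟩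
      rw [hk]
      simp only [Equiv.inv_apply, Units.val_inv_eq_inv_val, Nat.add_sub_cancel]
      rw [pow_succ, mul_assoc, inv_mul_cancel₀ c.ne_zero, mul_one]
    rw [h2, FiniteField.sum_pow_units, hq]
    have hlt : p ^ j < p ^ f := Nat.pow_lt_pow_right (by omega) (Finset.mem_range.1 hj)
    have hpos : 0 < p ^ j := by positivity
    by_cases hj0 : j = 0
    · subst hj0; simp
    · rw [if_neg hj0, if_neg]
      intro hdvd
      have h3 : 1 < p ^ j := Nat.one_lt_pow hj0 (by omega)
      have := Nat.le_of_dvd (by omega) hdvd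
      omega
  simp only [Finset.sum_mul]
  rw [Finset.sum_comm, Finset.sum_congr rfl h1]
  simp [hf]

/-- Modulo `augIdeal ^ 2`, the map `y ↦ [y] - 1` is the sum of its semilinear parts. -/
lemma dl_add_sum_slot [hp : Fact p.Prime] [CharP F p] {f : ℕ} (hf : 0 < f)
    (hq : Fintype.card F = p ^ f) (y : V) :
    dl F y + ∑ j ∈ Finset.range f, slot F p y j ∈ augIdeal F V ^ 2 := by
  have h1 : ∑ j ∈ Finset.range f, slot F p y j =
      ∑ c : Fˣ, (∑ j ∈ Finset.range f, ((c : F)⁻¹) ^ p ^ j) • dl F ((c : F) • y) := by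
    simp only [slot, Finset.sum_smul]
    rw [Finset.sum_comm]
  -- The coefficients lie in the prime field, so modulo `augIdeal ^ 2` they may be moved inside
  -- `dl`; the vectors then add up to `-y`.
  choose n hn using fun c : Fˣ => exists_natCast_eq_sum_frobenius p hq ((c : F)⁻¹)
  have h2 : ∑ c : Fˣ, ((n c : F) • ((c : F) • y)) = -y := by
    simp only [smul_smul, ← Finset.sum_smul, ← hn]
    rw [sum_units_frobenius p hf hq, neg_smul, one_smul]
  have h3 := dl_sum (F := F) Finset.univ (fun c : Fˣ => (n c : F) • ((c : F) • y))
  have h4 : ∑ c : Fˣ, (dl F ((n c : F) • ((c : F) • y)) - (n c : F) • dl F ((c : F) • y)) ∈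
      augIdeal F V ^ 2 := Ideal.sum_mem _ fun c _ => dl_natCast_smul _ _
  rw [Finset.sum_sub_distrib] at h4
  have h5 : dl F y + dl F (-y) ∈ augIdeal F V ^ 2 := by
    have : dl F y + dl F (-y) = - (dl F y * dl F (-y)) := by
      have h := dl_add (R := F) y (-y)
      rw [add_neg_cancel, dl_zero] at h
      linear_combination -h
    rw [this]
    exact neg_mem (dl_mul_dl_mem _ _)
  rw [h2] at h3
  rw [h1, Finset.sum_congr rfl fun c _ => by rw [hn c]]
  have := sub_mem h5 (add_mem h3 h4)
  convert this using 1
  ring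

/-- The product of a family of slot elements. -/
noncomputable def slotProd (F : Type*) [Field F] [Fintype F] [DecidableEq F] {V : Type*}
    [AddCommGroup V] [Module F V] (p : ℕ) {f : ℕ} (Y : Multiset (V × Fin f)) : AddMonoidAlgebra F V :=
  (Y.map fun z => slot F p z.1 z.2).prod

lemma slotProd_cons {f : ℕ} (z : V × Fin f) (Y : Multiset (V × Fin f)) :
    slotProd F p (z ::ₘ Y) = slot F p z.1 z.2 * slotProd F p Y := by simp [slotProd]

lemma slotProd_mem {f : ℕ} (Y : Multiset (V × Fin f)) :
    slotProd F p Y ∈ augIdeal F V ^ Y.card := by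
  induction Y using Multiset.induction_on with
  | empty => simp [slotProd]
  | cons z Y ih =>
    rw [slotProd_cons, Multiset.card_cons, pow_succ']
    exact Ideal.mul_mem_mul (slot_mem p _ _) ih

/-- Multiplication by `a` on `V` scales a factor of type `j` by `a ^ p ^ j`, whereas it leaves `u`
unchanged. -/
lemma lext_smul_unit (u : V → F) (hu : ∀ (a : Fˣ) x, u ((a : F) • x) = u x) {f : ℕ}
    [hp : Fact p.Prime] (Y : Multiset (V × Fin f)) (a : Fˣ) :
    lext u (slotProd F p Y) =
      (a : F) ^ (Y.map fun z => p ^ (z.2 : ℕ)).sum * lext u (slotProd F p Y) := by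
  have h1 : push F (DistribSMul.toAddMonoidHom V (a : F)) (slotProd F p Y) =
      ((a : F) ^ (Y.map fun z => p ^ (z.2 : ℕ)).sum) • slotProd F p Y := by
    induction Y using Multiset.induction_on with
    | empty => simp [slotProd]
    | cons z Y ih =>
      have h2 : push F (DistribSMul.toAddMonoidHom V (a : F)) (slot F p z.1 z.2) =
          ((a : F) ^ p ^ (z.2 : ℕ)) • slot F p z.1 z.2 := by
        rw [← slot_smul, slot, slot, map_sum]
        refine Finset.sum_congr rfl fun c _ => ?_
        rw [map_smul, push_dl]
        simp [smul_smul, mul_comm]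
      rw [slotProd_cons, map_mul, ih, h2, Multiset.map_cons, Multiset.sum_cons, pow_add,
        smul_mul_smul_comm]
  have h3 := lext_push (DistribSMul.toAddMonoidHom V (a : F)) u (slotProd F p Y)
  rw [h1, map_smul, smul_eq_mul] at h3
  rw [h3]
  congr 1
  congr 1
  funext x
  exact (hu a x).symm

lemma lext_slotProd_eq_zero [hp : Fact p.Prime] {f : ℕ} (hq : Fintype.card F = p ^ f) (u : V → F)
    (hu : ∀ (a : Fˣ) x, u ((a : F) • x) = u x) (Y : Multiset (V × Fin f))
    (hY : ¬ (p ^ f - 1 ∣ (Y.map fun z => p ^ (z.2 : ℕ)).sum)) :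
    lext u (slotProd F p Y) = 0 := by
  classical
  rw [← hq, ← FiniteField.forall_pow_eq_one_iff F] at hY
  push Not at hY
  obtain ⟨a, ha⟩ := hY
  have h := lext_smul_unit p u hu Y a
  have h2 : (a : F) ^ (Y.map fun z => p ^ (z.2 : ℕ)).sum ≠ 1 := by
    intro h; apply ha; ext; simpa using h
  have h3 : ((a : F) ^ (Y.map fun z => p ^ (z.2 : ℕ)).sum - 1) * lext u (slotProd F p Y) = 0 := by
    linear_combination -h
  rcases mul_eq_zero.1 h3 with h4 | h4
  · exact absurd (sub_eq_zero.1 h4) h2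
  · exact h4

/-- A functional vanishing on `augIdeal ^ (m + 1)` and on all products of `m` slot elements
vanishes on `augIdeal ^ m`. -/
lemma eq_zero_on_pow_of_slotProd [hp : Fact p.Prime] [CharP F p] {f : ℕ} (hf : 0 < f)
    (hq : Fintype.card F = p ^ f) (Λ : AddMonoidAlgebra F V →ₗ[F] F) (m : ℕ)
    (h1 : ∀ r ∈ augIdeal F V ^ (m + 1), Λ r = 0)
    (h2 : ∀ Y : Multiset (V × Fin f), Y.card = m → Λ (slotProd F p Y) = 0) :
    ∀ r ∈ augIdeal F V ^ m, Λ r = 0 := by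
  -- Generators `dl F y` are exchanged one at a time for sums of slots; each exchange has an error
  -- in `augIdeal ^ (m + 1)`.
  suffices H : ∀ i ≤ m, ∀ r ∈ augIdeal F V ^ i, ∀ Y : Multiset (V × Fin f), Y.card + i = m →
      Λ (r * slotProd F p Y) = 0 by
    intro r hr
    have := H m le_rfl r hr 0 (by simp)
    simpa [slotProd] using this
  intro i
  induction i with
  | zero =>
    intro _ r _ Y hY
    rw [add_zero] at hY
    induction r using alg_induction with
    | h0 => simp
    | hadd a b ha hb => rw [add_mul, map_add, ha (by simp), hb (by simp), add_zero]
    | hpt c g =>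
      rw [smul_mul_assoc, map_smul, pt_eq, add_mul, map_add, one_mul, h2 Y hY, h1 _ ?_]
      · simp
      · have := slotProd_mem (F := F) p Y
        rw [hY] at this
        rw [pow_succ']
        exact Ideal.mul_mem_mul (dl_mem _) this
  | succ i ih =>
    intro him r hr Y hY
    rw [pow_succ] at hr
    refine Submodule.mul_induction_on hr ?_ ?_
    · intro s hs t ht
      rw [augIdeal] at ht
      suffices ∀ s ∈ augIdeal F V ^ i, Λ (s * t * slotProd F p Y) = 0 from this s hs
      clear hs s hr
      refine Submodule.span_induction ?_ ?_ ?_ ?_ ht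
      · rintro _ ⟨y, rfl⟩ s hs
        have h3 := dl_add_sum_slot p hf hq y
        have h4 : Λ (s * (dl F y + ∑ j ∈ Finset.range f, slot F p y j) * slotProd F p Y) = 0 := by
          apply h1
          have : m + 1 = i + 2 + Y.card := by omega
          rw [this, pow_add, pow_add]
          exact Ideal.mul_mem_mul (Ideal.mul_mem_mul hs h3) (slotProd_mem p Y)
        rw [mul_add, add_mul, map_add, Finset.mul_sum, Finset.sum_mul, map_sum] at h4
        rw [Finset.sum_eq_zero, add_zero] at h4
        · exact h4
        · intro j hj
          have := ih (by omega) s hs ((y, ⟨j, Finset.mem_range.1 hj⟩) ::ₘ Y) (by simp; omega)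
          rw [slotProd_cons] at this
          rw [mul_assoc]; exact this
      · intro s _; simp
      · intro a b _ _ ha hb s hs
        rw [mul_add, add_mul, map_add, ha s hs, hb s hs, add_zero]
      · intro a b _ hb s hs
        rw [smul_eq_mul, ← mul_assoc]
        exact hb (s * a) (Ideal.mul_mem_right _ _ hs)
    · intro a b ha hb
      rw [add_mul, map_add, ha, hb, add_zero]

end Slot

end GroupAlg

/-! ### Polarization along lines. -/

namespace GroupAlg

section Low

variable {F : Type*} [Field F] [Fintype F] [DecidableEq F] {V : Type*} [AddCommGroup V] [Module F V]
variable (p : ℕ)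

omit [DecidableEq F] in
/-- A polynomial over an algebra of degree less than `|F|`, whose values at `F` are killed by a
functional, has all its coefficients killed. -/
lemma coeff_eq_zero_of_forall_eval {R : Type*} [CommRing R] [Algebra F R] (Λ : R →ₗ[F] F)
    (P : Polynomial R) (hdeg : P.natDegree < Fintype.card F)
    (h : ∀ a : F, Λ (P.eval (algebraMap F R a)) = 0) (n : ℕ) : Λ (P.coeff n) = 0 := by
  set Q : Polynomial F := ∑ i ∈ Finset.range (Fintype.card F),
    Polynomial.monomial i (Λ (P.coeff i)) with hQ
  have hcoeff : ∀ n, Q.coeff n = if n < Fintype.card F then Λ (P.coeff n) else 0 := by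
    intro n
    simp [hQ, Polynomial.coeff_monomial]
  have hQ0 : Q = 0 := by
    apply Polynomial.eq_zero_of_natDegree_lt_card_of_eval_eq_zero Q
      (f := fun a : F => a) Function.injective_id
    · intro a
      rw [hQ, Polynomial.eval_finsetSum, ← h a, Polynomial.eval_eq_sum_range' hdeg, map_sum]
      refine Finset.sum_congr rfl fun i _ => ?_
      rw [Polynomial.eval_monomial, ← map_pow, mul_comm (P.coeff i), ← Algebra.smul_def, map_smul,
        smul_eq_mul, mul_comm]
    · rw [Nat.lt_iff_add_one_le, ← Nat.lt_iff_add_one_le]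
      refine lt_of_le_of_lt (b := Fintype.card F - 1) ?_ ?_
      · refine Polynomial.natDegree_le_iff_coeff_eq_zero.2 fun N hN => ?_
        rw [hcoeff, if_neg (by omega)]
      · have := Fintype.card_pos (α := F)
        omega
  by_cases hn : n < Fintype.card F
  · have := hcoeff n
    rwa [hQ0, if_pos hn, Polynomial.coeff_zero, eq_comm] at this
  · rw [Polynomial.coeff_eq_zero_of_natDegree_lt (by omega), map_zero]

/-- The cyclic distance from `j` to `i` modulo `f`. -/
def cycDist (f j i : ℕ) : ℕ := if j ≤ i then i - j else f - j + i

lemma cycDist_lt {f : ℕ} (j i : Fin f) : cycDist f j i < f := by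
  have := i.2; have := j.2
  unfold cycDist; split_ifs <;> omega

lemma cycDist_injective {f : ℕ} (j : Fin f) : Function.Injective fun i : Fin f => cycDist f j i := by
  intro a b h
  have := a.2; have := j.2; have := b.2
  ext
  simp only [cycDist] at h
  split_ifs at h <;> omega

lemma cycDist_eq_zero {f : ℕ} {j i : Fin f} : cycDist f j i = 0 ↔ i = j := by
  have := i.2; have := j.2
  rw [Fin.ext_iff]
  unfold cycDist; split_ifs <;> omega

omit [DecidableEq F] in
-- Since `x ^ p ^ f = x`, substituting `x ^ p ^ (f - j)` shifts the Frobenius exponents cyclically,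
-- so that type `j` becomes linear in `x`.
lemma pow_cycDist {f : ℕ} (hq : Fintype.card F = p ^ f) (j i : Fin f) (x : F) :
    (x ^ p ^ (f - j : ℕ)) ^ p ^ (i : ℕ) = x ^ p ^ cycDist f j i := by
  have := i.2; have := j.2
  rw [← pow_mul, ← pow_add]
  unfold cycDist
  split_ifs with h
  · rw [show (f - j + i : ℕ) = f + (i - j) by omega, pow_add, pow_mul, ← hq, FiniteField.pow_card]
  · rfl

/-- The cyclic distances are distinct and below `f`, so this is a base-`p` expansion with `f`
digits. It keeps the degree in `polarize` below `q`. -/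
lemma sum_mul_pow_cycDist_lt {p f : ℕ} (hp : 1 ≤ p) (j : Fin f) (T : Fin f → ℕ)
    (hT : ∀ i, T i ≤ p - 1) : ∑ i : Fin f, T i * p ^ cycDist f j i < p ^ f := by
  have h1 : ∑ i : Fin f, T i * p ^ cycDist f j i ≤ ∑ i : Fin f, (p - 1) * p ^ cycDist f j i :=
    Finset.sum_le_sum fun i _ => Nat.mul_le_mul_right _ (hT i)
  have h2 : ∑ i : Fin f, p ^ cycDist f j i ≤ ∑ i ∈ Finset.range f, p ^ i := by
    rw [← Finset.sum_image (f := fun n => p ^ n) (s := Finset.univ)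
      (g := fun i : Fin f => cycDist f j i) (fun a _ b _ h => cycDist_injective j h)]
    refine Finset.sum_le_sum_of_subset ?_
    intro n hn
    obtain ⟨i, -, rfl⟩ := Finset.mem_image.1 hn
    exact Finset.mem_range.2 (cycDist_lt j i)
  rw [← Finset.mul_sum] at h1
  have h3 := sub_one_mul_geom_sum (show 0 < p by omega) f
  have := Nat.mul_le_mul_left (p - 1) h2
  omega

lemma coeff_one_prod_mul {R ι : Type*} [CommRing R] [DecidableEq ι] (s : Finset ι) {j : ι}
    (hj : j ∈ s) (P : ι → Polynomial R) (h : ∀ i ∈ s.erase j, (P i).coeff 1 = 0) (w : R) :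
    ((∏ i ∈ s, P i) * Polynomial.C w).coeff 1 =
      (P j).coeff 1 * (∏ i ∈ s.erase j, (P i).coeff 0) * w := by
  rw [Polynomial.coeff_mul_C, ← Finset.mul_prod_erase s P hj, Polynomial.mul_coeff_one,
    coeff_one_prod_eq_zero _ _ h, mul_zero, zero_add, Polynomial.coeff_zero_eq_eval_zero,
    Polynomial.eval_prod]
  simp only [Polynomial.coeff_zero_eq_eval_zero]

lemma slot_line [hp : Fact p.Prime] (c b : V) (a : F) (i : ℕ) :
    LeadEq (augIdeal F V) 1 (slot F p (c + a • b) i)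
      (slot F p c i + (a ^ p ^ i) • slot F p b i) := by
  refine ⟨?_, ?_, ?_⟩
  · rw [pow_one]; exact slot_mem p _ _
  · rw [pow_one]; exact add_mem (slot_mem p _ _) (smul_mem_ideal _ (slot_mem p _ _))
  · rw [← slot_smul]; exact slot_add p _ _ _

/-- Polarization: the coefficient extraction along a line on which a product of slot elements is
killed. -/
lemma polarize [hp : Fact p.Prime] [CharP F p] {f : ℕ} (hq : Fintype.card F = p ^ f)
    (Λ : AddMonoidAlgebra F V →ₗ[F] F) (m l : ℕ) (hΛ : ∀ r ∈ augIdeal F V ^ (m + 1), Λ r = 0)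
    (c b : V) (T : Fin f → ℕ) (hT : ∀ i, T i ≤ p - 1) (w : AddMonoidAlgebra F V)
    (hw : w ∈ augIdeal F V ^ l) (hm : ∑ i, T i + l = m)
    (h : ∀ a : F, Λ ((∏ i : Fin f, slot F p (c + a • b) i ^ T i) * w) = 0) (j : Fin f) (hj : 0 < T j) :
    Λ (slot F p b j * slot F p c j ^ (T j - 1) *
      (∏ i ∈ Finset.univ.erase j, slot F p c i ^ T i) * w) = 0 := by
  -- `P i` at `x` is the leading form of the slot of type `i` at `c + x ^ p ^ (f - j) • b`. Only `P
  -- j` has a term in `X ^ 1`.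
  obtain ⟨P, hP⟩ : ∃ P : Fin f → Polynomial (AddMonoidAlgebra F V), ∀ i, P i =
    Polynomial.C (slot F p c i) + Polynomial.C (slot F p b i) * Polynomial.X ^ p ^ cycDist f j i :=
    ⟨_, fun _ => rfl⟩
  have hp2 := hp.out.two_le
  have hdeg : ((∏ i, P i ^ T i) * Polynomial.C w).natDegree < Fintype.card F := by
    rw [hq]
    refine lt_of_le_of_lt ?_ (sum_mul_pow_cycDist_lt (by omega) j T hT)
    refine (Polynomial.natDegree_mul_C_le _ _).trans ?_
    refine (Polynomial.natDegree_prod_le _ _).trans ?_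
    refine Finset.sum_le_sum fun i _ => ?_
    refine Polynomial.natDegree_pow_le.trans ?_
    refine Nat.mul_le_mul_left _ ?_
    rw [hP]
    refine Polynomial.natDegree_add_le_of_degree_le (by simp) ?_
    exact Polynomial.natDegree_C_mul_X_pow_le _ _
  have heval : ∀ x : F, Λ (((∏ i, P i ^ T i) * Polynomial.C w).eval (algebraMap F _ x)) = 0 := by
    intro x
    have h1 := h (x ^ p ^ (f - j : ℕ))
    have h2 := (LeadEq.prod Finset.univ T _ _ fun i _ =>
      (slot_line p c b (x ^ p ^ (f - j : ℕ)) (i : ℕ)).pow (T i)).mul (LeadEq.refl hw)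
    have h3 := hΛ _ (hm ▸ h2.2.2)
    rw [map_sub, h1, zero_sub, neg_eq_zero] at h3
    have h4 : ∀ i ∈ Finset.univ, (P i ^ T i).eval (algebraMap F _ x) = (slot F p c i +
        ((x ^ p ^ (f - j : ℕ)) ^ p ^ (i : ℕ)) • slot F p b i) ^ T i := by
      intro i _
      rw [Polynomial.eval_pow, pow_cycDist p hq, Algebra.smul_def, map_pow,
        mul_comm (algebraMap F _ x ^ _)]
      simp only [hP, Polynomial.eval_add, Polynomial.eval_mul, Polynomial.eval_C,
        Polynomial.eval_pow, Polynomial.eval_X]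
    rw [Polynomial.eval_mul, Polynomial.eval_C, Polynomial.eval_prod, Finset.prod_congr rfl h4]
    exact h3
  have hc := coeff_eq_zero_of_forall_eval Λ _ hdeg heval 1
  have hP0 : ∀ i, (P i).coeff 0 = slot F p c i := by
    intro i
    have : p ^ cycDist f j i ≠ 0 := pow_ne_zero _ (by omega)
    simp [hP, Polynomial.coeff_X_pow, this.symm]
  have hP1 : (P j).coeff 1 = slot F p b j := by
    simp [hP, cycDist_eq_zero.2 (rfl : j = j), Polynomial.coeff_C]
  have hP1' : ∀ i ∈ Finset.univ.erase j, (P i ^ T i).coeff 1 = 0 := by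
    intro i hi
    have h0 : cycDist f j i ≠ 0 := fun h => Finset.ne_of_mem_erase hi (cycDist_eq_zero.1 h)
    have h1 : 1 < p ^ cycDist f j i := Nat.one_lt_pow h0 (by omega)
    rw [coeff_one_pow']
    simp [hP, Polynomial.coeff_X_pow, h1.ne, Polynomial.coeff_C]
  have h5 : ∀ i, (P i ^ T i).coeff 0 = slot F p c i ^ T i := by
    intro i
    rw [Polynomial.coeff_zero_eq_eval_zero, Polynomial.eval_pow,
      ← Polynomial.coeff_zero_eq_eval_zero, hP0]
  rw [coeff_one_prod_mul Finset.univ (Finset.mem_univ j) (fun i => P i ^ T i) hP1' w] at hc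
  simp only [h5] at hc
  rw [coeff_one_pow', hP1, hP0] at hc
  -- The linear coefficient carries the factor `T j`, which is invertible because `0 < T j < p`.
  have hTj : (T j : F) ≠ 0 := by
    intro h
    have := Nat.le_of_dvd hj ((CharP.cast_eq_zero_iff F p _).1 h)
    have := hT j
    omega
  have h6 : (T j : AddMonoidAlgebra F V) = algebraMap F _ (T j : F) := by rw [map_natCast]
  rw [h6, mul_assoc, mul_assoc, mul_assoc, ← Algebra.smul_def, map_smul, smul_eq_mul] at hc
  have h7 := (mul_eq_zero.1 hc).resolve_left hTj
  refine Eq.trans (congrArg Λ ?_) h7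
  ring

/-- Since `Λ` kills `augIdeal ^ (n + 2)`, the map `y ↦ Λ (slot F p y j * ρ)` is semilinear. -/
lemma slot_mul_eq_zero_of_mem_span [hp : Fact p.Prime] (Λ : AddMonoidAlgebra F V →ₗ[F] F) {n : ℕ}
    (hΛ : ∀ r ∈ augIdeal F V ^ (n + 2), Λ r = 0) {ρ : AddMonoidAlgebra F V}
    (hρ : ρ ∈ augIdeal F V ^ n) (j : ℕ) {X : Set V} (hX : ∀ x ∈ X, Λ (slot F p x j * ρ) = 0)
    {y : V} (hy : y ∈ Submodule.span F X) : Λ (slot F p y j * ρ) = 0 := by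
  induction hy using Submodule.span_induction with
  | mem x hx => exact hX x hx
  | zero => simp [slot, dl_zero]
  | add x x' _ _ hx hx' =>
    have h1 : Λ ((slot F p (x + x') j - (slot F p x j + slot F p x' j)) * ρ) = 0 := by
      apply hΛ
      rw [add_comm n, pow_add]
      exact Ideal.mul_mem_mul (slot_add p _ _ _) hρ
    rw [sub_mul, add_mul, map_sub, map_add, hx, hx', add_zero, sub_zero] at h1
    exact h1
  | smul a x _ hx => rw [slot_smul, smul_mul_assoc, map_smul, hx, smul_zero]

/-- If a set `A` is covered by enough lines, then vanishing of a functional on the powers of slot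
elements at the points of `A` implies its vanishing on all products of slot elements of the same
type. -/
lemma eq_zero_of_diagonal [hp : Fact p.Prime] [CharP F p] {f : ℕ} (hq : Fintype.card F = p ^ f)
    (Λ : AddMonoidAlgebra F V →ₗ[F] F) (m : ℕ) (hΛ : ∀ r ∈ augIdeal F V ^ (m + 1), Λ r = 0)
    (A : Set V) (hA : A.Nonempty) (B : V → Set V) (S : Set V)
    (hAB : ∀ c ∈ A, ∀ b ∈ B c, ∀ a : F, c + a • b ∈ A)
    (hspan : ∀ c ∈ A, Submodule.span F (B c ∪ {c} ∪ S) = ⊤)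
    (Y : Multiset (V × Fin f)) (w : AddMonoidAlgebra F V) (l : ℕ) (hw : w ∈ augIdeal F V ^ l)
    (hm : Y.card + l = m) (hY : ∀ j, (Y.map Prod.snd).count j ≤ p - 1)
    (hS : ∀ j ∈ Y.map Prod.snd, ∀ b ∈ S, slot F p b j * w ∈ augIdeal F V ^ (l + 2))
    (h : ∀ c ∈ A, Λ ((∏ j : Fin f, slot F p c j ^ (Y.map Prod.snd).count j) * w) = 0) :
    Λ (slotProd F p Y * w) = 0 := by
  induction Y using Multiset.induction_on generalizing w l with
  | empty =>
    obtain ⟨c, hc⟩ := hA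
    simpa [slotProd] using h c hc
  | cons z Y ih =>
    obtain ⟨y, j⟩ := z
    rw [slotProd_cons, mul_assoc, mul_left_comm]
    set T : Fin f → ℕ := fun i => (((y, j) ::ₘ Y).map Prod.snd).count i with hTdef
    have hTe : ∀ i, i ≠ j → T i = (Y.map Prod.snd).count i := fun i hi => by
      simp [hTdef, Multiset.count_cons, hi]
    have hTj : T j = (Y.map Prod.snd).count j + 1 := by simp [hTdef]
    have hTsum : ∑ i, T i + l = m := by
      rw [← hm, hTdef]
      congr 1
      rw [← Multiset.card_map (Prod.snd : V × Fin f → Fin f)]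
      exact Multiset.sum_count_eq_card fun _ _ => Finset.mem_univ _
    have hle : ∀ i, (Y.map Prod.snd).count i ≤ T i := fun i => by
      simp only [hTdef, Multiset.map_cons]; exact Multiset.count_le_count_cons _ _ _
    rw [Multiset.card_cons] at hm
    -- The factor at `y` is absorbed into `w`. By semilinearity in `y`, the diagonal hypothesis for
    -- the smaller `Y` needs checking only on `B c` (polarization), at `c` (the given diagonal) and
    -- on `S` (degree too high).
    refine ih (slot F p y j * w) (l + 1) ?_ (by omega) (fun i => (hle i).trans (hY i)) ?_ ?_
    · rw [pow_succ']; exact Ideal.mul_mem_mul (slot_mem p _ _) hw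
    · intro i hi b hb
      rw [mul_left_comm, show l + 1 + 2 = l + 2 + 1 by ring, pow_succ']
      exact Ideal.mul_mem_mul (slot_mem p _ _)
        (hS i (by rw [Multiset.map_cons]; exact Multiset.mem_cons_of_mem hi) b hb)
    · intro c hc
      set ρ := (∏ i : Fin f, slot F p c i ^ (Y.map Prod.snd).count i) * w with hρ
      have hprod : (∏ i : Fin f, slot F p c i ^ (Y.map Prod.snd).count i) ∈
          augIdeal F V ^ Y.card := by
        have h1 : ∑ i, (Y.map Prod.snd).count i = Y.card := by
          rw [← Multiset.card_map (Prod.snd : V × Fin f → Fin f)]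
          exact Multiset.sum_count_eq_card fun _ _ => Finset.mem_univ _
        rw [← h1, ← Finset.prod_pow_eq_pow_sum]
        exact Ideal.prod_mem_prod fun i _ => Ideal.pow_mem_pow (slot_mem p _ _) _
      have hρm : ρ ∈ augIdeal F V ^ (Y.card + l) := by
        rw [pow_add]; exact Ideal.mul_mem_mul hprod hw
      have hprode : ∀ g : Fin f → ℕ, g j + 1 = T j → (∀ i, i ≠ j → g i = T i) →
          ∏ i : Fin f, slot F p c i ^ g i = slot F p c j ^ (T j - 1) *
            ∏ i ∈ Finset.univ.erase j, slot F p c i ^ T i := by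
        intro g hg1 hg2
        rw [← Finset.mul_prod_erase _ _ (Finset.mem_univ j), ← hg1, Nat.add_sub_cancel]
        congr 1
        exact Finset.prod_congr rfl fun i hi => by rw [hg2 i (Finset.ne_of_mem_erase hi)]
      have hρe := hprode (fun i => (Y.map Prod.snd).count i) hTj.symm fun i hi => (hTe i hi).symm
      rw [mul_left_comm]
      refine slot_mul_eq_zero_of_mem_span p Λ (n := Y.card + l)
        (by rwa [show Y.card + l + 2 = m + 1 by omega]) hρm j (X := B c ∪ {c} ∪ S) ?_
        (by rw [hspan c hc]; trivial)
      · rintro b ((hb | hb) | hb)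
        · have h1 := polarize p hq Λ m l hΛ c b T hY w hw hTsum
            (fun a => h _ (hAB c hc b hb a)) j (by omega)
          show Λ (slot F p b j * ρ) = 0
          rw [hρ, hρe]
          refine Eq.trans (congrArg Λ ?_) h1
          ring
        · rw [Set.mem_singleton_iff.1 hb]
          have h1 := h c hc
          show Λ (slot F p c j * ρ) = 0
          rw [hρ, hρe]
          refine Eq.trans (congrArg Λ ?_) h1
          rw [← Finset.mul_prod_erase Finset.univ (fun i : Fin f =>
            slot F p c i ^ (((y, j) ::ₘ Y).map Prod.snd).count i) (Finset.mem_univ j)]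
          change _ = slot F p c j ^ T j * (∏ i ∈ Finset.univ.erase j, slot F p c i ^ T i) * w
          rw [show T j = T j - 1 + 1 by omega, pow_succ]
          simp only [Nat.add_sub_cancel]
          ring
        · apply hΛ
          rw [hρ, mul_left_comm, show m + 1 = Y.card + (l + 2) by omega, pow_add]
          exact Ideal.mul_mem_mul hprod (hS j (by simp) b hb)

end Low

end GroupAlg

/-! ### Digit sums of multiples of `p ^ f - 1`. -/

section Carry

variable {f : ℕ} (p : ℕ)

lemma exists_pow_succ_eq (hp : 1 ≤ p) (j : Fin f) :
    ∃ (k : Fin f) (c : ℕ), p ^ ((j : ℕ) + 1) = p ^ (k : ℕ) + c * (p ^ f - 1) := by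
  have hpf : 1 ≤ p ^ f := Nat.one_le_pow _ _ hp
  by_cases h : (j : ℕ) + 1 < f
  · exact ⟨⟨_, h⟩, 0, by simp⟩
  · refine ⟨⟨0, by have := j.2; omega⟩, 1, ?_⟩
    have : (j : ℕ) + 1 = f := by have := j.2; omega
    rw [this]; simp; omega

/-- Carrying in a base-`p` expansion modulo `p ^ f - 1`. -/
lemma exists_carry (hp : 2 ≤ p) (n : Fin f → ℕ) (h : p ^ f - 1 ∣ ∑ i, n i * p ^ (i : ℕ))
    (j : Fin f) (hj : p ≤ n j) :
    ∃ n' : Fin f → ℕ, (p ^ f - 1 ∣ ∑ i, n' i * p ^ (i : ℕ)) ∧ ∑ i, n' i + (p - 1) = ∑ i, n i ∧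
      0 < ∑ i, n' i ∧ ∀ i, n i ≤ n' i + if i = j then p else 0 := by
  obtain ⟨k, c, hk⟩ := exists_pow_succ_eq p (by omega) j
  obtain ⟨g, hg⟩ : ∃ g : Fin f → ℕ, ∀ i, n i = g i + if i = j then p else 0 := by
    refine ⟨fun i => n i - if i = j then p else 0, fun i => ?_⟩
    by_cases hi : i = j
    · subst hi; simp; omega
    · simp [hi]
  have hs : ∑ i, n i = ∑ i, g i + p := by simp [hg, Finset.sum_add_distrib]
  have hs' : ∑ i, n i * p ^ (i : ℕ) = ∑ i, g i * p ^ (i : ℕ) + p ^ ((j : ℕ) + 1) := by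
    simp only [hg, add_mul, Finset.sum_add_distrib]
    simp [pow_succ, mul_comm]
  refine ⟨fun i => g i + if i = k then 1 else 0, ?_, ?_, ?_, ?_⟩
  · rw [hs', hk, ← add_assoc, Nat.dvd_add_left (dvd_mul_left _ _)] at h
    simpa [add_mul, Finset.sum_add_distrib] using h
  · rw [hs]; simp [Finset.sum_add_distrib]; omega
  · simp [Finset.sum_add_distrib]
  · intro i; rw [hg]; simp only; split_ifs <;> omega

/-- A nonzero multiple of `p ^ f - 1` has digit sum at least `f * (p - 1)`. -/
lemma mul_le_sum_of_dvd (hp : 2 ≤ p) (n : Fin f → ℕ)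
    (h : p ^ f - 1 ∣ ∑ i, n i * p ^ (i : ℕ)) (h0 : 0 < ∑ i, n i) : f * (p - 1) ≤ ∑ i, n i := by
  induction hN : ∑ i, n i using Nat.strong_induction_on generalizing n with
  | _ N ih =>
    by_cases hj : ∃ j, p ≤ n j
    · obtain ⟨j, hj⟩ := hj
      obtain ⟨n', h1, h2, h3, -⟩ := exists_carry p hp n h j hj
      have := ih _ (by omega) n' h1 h3 rfl
      omega
    · push Not at hj
      -- When no carry is possible, a positive multiple of `p ^ f - 1` must have all digits equal to
      -- `p - 1`.
      have hgeom : ∑ i : Fin f, (p - 1) * p ^ (i : ℕ) = p ^ f - 1 := by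
        rw [Fin.sum_univ_eq_sum_range (fun i => (p - 1) * p ^ i), ← Finset.mul_sum]
        have := sub_one_mul_geom_sum (show 0 < p by omega) f
        omega
      obtain ⟨j, -, hjpos⟩ := Finset.exists_ne_zero_of_sum_ne_zero (by omega : ∑ i, n i ≠ 0)
      have hpos : 0 < ∑ i, n i * p ^ (i : ℕ) := by
        refine lt_of_lt_of_le (b := n j * p ^ (j : ℕ)) (by positivity) ?_
        exact Finset.single_le_sum (f := fun i => n i * p ^ (i : ℕ)) (fun _ _ => Nat.zero_le _)
          (Finset.mem_univ j)
      have hle := Nat.le_of_dvd hpos h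
      rw [← hgeom] at hle
      have hle' : ∀ i ∈ Finset.univ, n i * p ^ (i : ℕ) ≤ (p - 1) * p ^ (i : ℕ) := fun i _ =>
        Nat.mul_le_mul_right _ (by have := hj i; omega)
      have heq := (Finset.sum_eq_sum_iff_of_le hle').1 (le_antisymm (Finset.sum_le_sum hle') hle)
      have : ∀ i ∈ Finset.univ, n i = p - 1 := fun i hi =>
        Nat.eq_of_mul_eq_mul_right (by positivity) (heq i hi)
      rw [← hN, Finset.sum_congr rfl this]
      simp

/-- One carry lowers the digit sum by `p - 1`, and what remains is still at least `f * (p - 1)`. -/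
lemma mul_le_sum_of_dvd_of_le (hp : 2 ≤ p) (n : Fin f → ℕ)
    (h : p ^ f - 1 ∣ ∑ i, n i * p ^ (i : ℕ)) (j : Fin f) (hj : p ≤ n j) :
    (f + 1) * (p - 1) ≤ ∑ i, n i := by
  obtain ⟨n', h1, h2, h3, -⟩ := exists_carry p hp n h j hj
  have := mul_le_sum_of_dvd p hp n' h1 h3
  rw [add_mul]
  omega

/-- The digit excess of a multiple of `p ^ f - 1` with small digit sum. -/
lemma sum_digit_excess_le_one (hp : 2 ≤ p) (hf : 0 < f) (e : ℕ) (he : 0 < e) (hef : e ≤ 2 ∨ f = 1)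
    (n : Fin f → ℕ) (h : p ^ f - 1 ∣ ∑ i, n i * p ^ (i : ℕ))
    (hn : ∑ i, n i ≤ (e + f - 1) * (p - 1)) : ∑ i, (n i - e * (p - 1)) ≤ 1 := by
  have hzero : (∀ i, n i ≤ e * (p - 1)) → ∑ i, (n i - e * (p - 1)) ≤ 1 := by
    intro h
    rw [Finset.sum_eq_zero fun i _ => Nat.sub_eq_zero_of_le (h i)]
    omega
  have hsmall : ∀ n : Fin f → ℕ, (p ^ f - 1 ∣ ∑ i, n i * p ^ (i : ℕ)) →
      ∑ i, n i ≤ f * (p - 1) → ∀ i, n i ≤ p - 1 := by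
    intro n h hn i
    by_contra hi
    have := mul_le_sum_of_dvd_of_le p hp n h i (by omega)
    rw [add_mul] at this
    omega
  by_cases hf1 : f = 1
  · apply hzero
    intro i
    have h1 := Finset.single_le_sum (f := n) (fun _ _ => Nat.zero_le _) (Finset.mem_univ i)
    have h2 : e + f - 1 = e := by omega
    rw [h2] at hn
    exact h1.trans hn
  · have he2 : e = 1 ∨ e = 2 := by omega
    rcases he2 with rfl | rfl
    · apply hzero
      intro i
      rw [one_mul]
      exact hsmall n h (by rwa [Nat.add_sub_cancel_left] at hn) i
    · by_cases hj : ∃ j, p ≤ n j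
      · obtain ⟨j, hj⟩ := hj
        obtain ⟨n', h1, h2, h3, h4⟩ := exists_carry p hp n h j hj
        -- After one carry all digits are at most `p - 1`; hence before it only digit `j` can exceed
        -- `2 * (p - 1)`, being at most `2 * p - 1`.
        have h5 := hsmall n' h1 (by
          rw [show 2 + f - 1 = f + 1 by omega, add_mul] at hn; omega)
        calc ∑ i, (n i - 2 * (p - 1)) ≤ ∑ i, if i = j then 1 else 0 := by
              refine Finset.sum_le_sum fun i _ => ?_
              have := h4 i; have := h5 i
              split_ifs at * <;> omega
          _ ≤ 1 := by simp
      · push Not at hj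
        apply hzero
        intro i
        have := hj i
        omega

end Carry

/-! ### The Griesmer number as a recursion. -/

section GriesmerFunction

/-- The Griesmer number, as a recursion over residual codes. -/
def residualSum (q : ℕ) : ℕ → ℕ → ℕ
  | 0, _ => 0
  | k + 1, d => d + residualSum q k (d ⌈/⌉ q)

lemma ceilDiv_ceilDiv (q i d : ℕ) (hq : 0 < q) : (d ⌈/⌉ q) ⌈/⌉ q ^ i = d ⌈/⌉ q ^ (i + 1) := by
  have h : 0 < q ^ i := by positivity
  have h' : 0 < q ^ (i + 1) := by positivity
  refine eq_of_forall_ge_iff fun c => ?_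
  rw [ceilDiv_le_iff_le_mul h, ceilDiv_le_iff_le_mul hq, ceilDiv_le_iff_le_mul h', pow_succ',
    mul_assoc]

lemma residualSum_eq (q k d : ℕ) (hq : 0 < q) :
    residualSum q k d = ∑ i ∈ Finset.range k, d ⌈/⌉ q ^ i := by
  induction k generalizing d with
  | zero => rfl
  | succ k ih =>
    rw [residualSum, ih, Finset.sum_range_succ', add_comm]
    simp [ceilDiv_ceilDiv _ _ _ hq]

lemma griesmerNumber_eq (q k d : ℕ) (hq : 0 < q) : griesmerNumber q k d = residualSum q k d := by
  rw [residualSum_eq _ _ _ hq, griesmerNumber]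
  refine Finset.sum_congr rfl fun i _ => ?_
  have h : 0 < q ^ i := by positivity
  refine eq_of_forall_ge_iff fun c => ?_
  rw [ceilDiv_le_iff_le_mul h, Nat.ceil_le, div_le_iff₀ (by positivity), mul_comm]
  exact_mod_cast Iff.rfl

lemma ceilDiv_mono {q a b : ℕ} (hq : 0 < q) (h : a ≤ b) : a ⌈/⌉ q ≤ b ⌈/⌉ q := by
  rw [ceilDiv_le_iff_le_mul hq]
  exact h.trans ((ceilDiv_le_iff_le_mul hq).1 le_rfl)

lemma le_mul_ceilDiv {q : ℕ} (d : ℕ) (hq : 0 < q) : d ≤ q * (d ⌈/⌉ q) :=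
  (ceilDiv_le_iff_le_mul hq).1 le_rfl

lemma mul_ceilDiv_lt {q : ℕ} (d : ℕ) (hq : 0 < q) : q * (d ⌈/⌉ q) < d + q := by
  rw [Nat.ceilDiv_eq_add_pred_div]
  have := Nat.mul_div_le (d + q - 1) q
  omega

lemma mul_ceilDiv_of_dvd {q d : ℕ} (hq : 0 < q) (h : q ∣ d) : q * (d ⌈/⌉ q) = d := by
  obtain ⟨k, rfl⟩ := h
  congr 1
  refine eq_of_forall_ge_iff fun c => ?_
  rw [ceilDiv_le_iff_le_mul hq]
  exact Nat.mul_le_mul_left_iff hq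

lemma residualSum_mono {q k a b : ℕ} (hq : 0 < q) (h : a ≤ b) :
    residualSum q k a ≤ residualSum q k b := by
  induction k generalizing a b with
  | zero => rfl
  | succ k ih => exact add_le_add h (ih (ceilDiv_mono hq h))

end GriesmerFunction

/-! ### Griesmer codes relative to a subspace, and their residual codes. -/

section Relative

variable {F : Type*} [Field F] [Fintype F] [DecidableEq F] {V : Type*} [AddCommGroup V] [Module F V]
  {ι : Type*} (ev : ι → V →ₗ[F] F)

/-- The weight of `x` on the coordinates in `s`. -/
def weight (s : Finset ι) (x : V) : ℕ := (s.filter fun i => ev i x ≠ 0).card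

/-- The coordinates in `s` at which `c` vanishes. -/
def zeros (s : Finset ι) (c : V) : Finset ι := s.filter fun i => ev i c = 0

omit [Fintype F] in
lemma card_zeros_add_weight (s : Finset ι) (c : V) :
    (zeros ev s c).card + weight ev s c = s.card :=
  Finset.card_filter_add_card_filter_not _

omit [Fintype F] in
lemma weight_smul (s : Finset ι) {a : F} (ha : a ≠ 0) (x : V) :
    weight ev s (a • x) = weight ev s x := by
  simp [weight, ha]

omit [Fintype F] in
lemma weight_add_of_forall_eq_zero {s : Finset ι} {x y : V} (h : ∀ i ∈ s, ev i y = 0) :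
    weight ev s (y + x) = weight ev s x := by
  unfold weight
  congr 1
  refine Finset.filter_congr fun i hi => ?_
  rw [map_add, h i hi, zero_add]

/-- The average weight along an affine line. -/
lemma sum_weight_line (s : Finset ι) (y c : V) :
    ∑ a : F, weight ev s (y + a • c) =
      (Fintype.card F - 1) * weight ev s c + Fintype.card F * weight ev (zeros ev s c) y := by
  have h1 : ∀ (s : Finset ι) (x : V), weight ev s x = ∑ i ∈ s, if ev i x ≠ 0 then 1 else 0 := by
    intro s x; rw [weight, Finset.card_filter]
  have h2 : ∀ i, ev i c ≠ 0 → (∑ a : F, if ev i (y + a • c) ≠ 0 then 1 else 0) =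
      Fintype.card F - 1 := by
    intro i hi
    rw [← Finset.card_filter]
    have : (Finset.univ.filter fun a : F => ev i (y + a • c) ≠ 0) =
        Finset.univ.erase (-(ev i y) / ev i c) := by
      ext a
      simp only [Finset.mem_filter, Finset.mem_univ, true_and, Finset.mem_erase, and_true, ne_eq,
        map_add, map_smul, smul_eq_mul, not_iff_not]
      rw [eq_div_iff hi]
      constructor <;> intro h <;> linear_combination h
    rw [this, Finset.card_erase_of_mem (Finset.mem_univ _), Finset.card_univ]
  have h3 : ∀ i, ev i c = 0 → (∑ a : F, if ev i (y + a • c) ≠ 0 then 1 else 0) =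
      Fintype.card F * if ev i y ≠ 0 then 1 else 0 := by
    intro i hi
    simp [hi]
  simp only [h1, zeros]
  rw [Finset.sum_comm, ← Finset.sum_filter_not_add_sum_filter s (fun i => ev i c = 0),
    Finset.sum_congr rfl fun i hi => h2 i (Finset.mem_filter.1 hi).2,
    Finset.sum_congr rfl fun i hi => h3 i (Finset.mem_filter.1 hi).2, ← Finset.mul_sum]
  congr 1
  rw [Finset.sum_const, smul_eq_mul, mul_comm, ← Finset.card_filter]

/-- Averaging over the line gives `q * d ≤ (q - 1) * d + q * w'`, where `w'` is the weight of `y` on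
the zeros of `c`. -/
lemma weight_zeros_of_forall_le {s : Finset ι} {y c : V} {d : ℕ} (hc : weight ev s c = d)
    (h : ∀ a : F, d ≤ weight ev s (y + a • c)) :
    d ⌈/⌉ Fintype.card F ≤ weight ev (zeros ev s c) y := by
  have hq : 0 < Fintype.card F := Fintype.card_pos
  rw [ceilDiv_le_iff_le_mul hq]
  have h1 := sum_weight_line ev s y c
  have h2 : ∑ _a : F, d ≤ ∑ a : F, weight ev s (y + a • c) := Finset.sum_le_sum fun a _ => h a
  rw [h1, hc, Finset.sum_const, Finset.card_univ, smul_eq_mul] at h2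
  obtain ⟨k, hk⟩ : ∃ k, Fintype.card F = k + 1 := ⟨Fintype.card F - 1, by omega⟩
  rw [hk, Nat.add_sub_cancel] at h2
  rw [hk]
  linarith

omit [Fintype F] [DecidableEq F] in
lemma add_smul_notMem_sup {U : Submodule F V} {b c : V} (hb : b ∉ U ⊔ F ∙ c) (a : F) :
    b + a • c ∉ U ⊔ F ∙ c := fun h => hb <| by
  have h2 : a • c ∈ U ⊔ F ∙ c :=
    Submodule.mem_sup_right (Submodule.smul_mem _ _ (Submodule.mem_span_singleton_self c))
  simpa using sub_mem h h2

variable [Module.Finite F V]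

omit [Fintype F] [DecidableEq F] in
lemma finrank_sup_span {U : Submodule F V} {c : V} (hc : c ∉ U) :
    Module.finrank F ↥(U ⊔ F ∙ c) = Module.finrank F U + 1 := by
  have h0 : c ≠ 0 := fun h => hc (h ▸ zero_mem _)
  have h1 := Submodule.finrank_sup_add_finrank_inf_eq U (F ∙ c)
  have h2 : U ⊓ F ∙ c = ⊥ := by
    rwa [← disjoint_iff, Submodule.disjoint_span_singleton' h0]
  rw [h2, finrank_bot, add_zero, finrank_span_singleton h0] at h1
  exact h1

omit [Fintype F] [Module.Finite F V] in
lemma exists_min_weight {U : Submodule F V} (s : Finset ι) (hU : U ≠ ⊤) :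
    ∃ c ∉ U, ∀ x ∉ U, weight ev s c ≤ weight ev s x := by
  obtain ⟨x, hx⟩ : ∃ x, x ∉ U := by
    by_contra h; push Not at h; exact hU (eq_top_iff.2 fun x _ => h x)
  have := Function.argminOn_mem (weight ev s) {x | x ∉ U} ⟨x, hx⟩
  exact ⟨_, this, fun y hy => Function.argminOn_le (weight ev s) {x | x ∉ U} hy⟩

omit [Fintype F] [Module.Finite F V] in
lemma zeros_vanish {U : Submodule F V} {s : Finset ι} (h0 : ∀ i ∈ s, ∀ x ∈ U, ev i x = 0) (c : V) :
    ∀ i ∈ zeros ev s c, ∀ x ∈ U ⊔ F ∙ c, ev i x = 0 := by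
  intro i hi x hx
  obtain ⟨hi1, hi2⟩ := Finset.mem_filter.1 hi
  have : U ⊔ F ∙ c ≤ LinearMap.ker (ev i) := by
    rw [sup_le_iff, Submodule.span_singleton_le_iff_mem]
    exact ⟨fun y hy => h0 i hi1 y hy, hi2⟩
  exact this hx

omit [Fintype F] [DecidableEq F] in
lemma finrank_lt_of_ne_top {U : Submodule F V} (h : U ≠ ⊤) :
    Module.finrank F U < Module.finrank F V := Submodule.finrank_lt h

/-- The Griesmer bound relative to a subspace `U` on which all coordinates vanish. -/
lemma residualSum_le_card {k : ℕ} {U : Submodule F V} {s : Finset ι} {d : ℕ}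
    (hk : Module.finrank F U + k = Module.finrank F V) (h0 : ∀ i ∈ s, ∀ x ∈ U, ev i x = 0)
    (hd : ∀ x ∉ U, d ≤ weight ev s x) : residualSum (Fintype.card F) k d ≤ s.card := by
  have hq : 0 < Fintype.card F := Fintype.card_pos
  induction k generalizing U s d with
  | zero => exact Nat.zero_le _
  | succ k ih =>
    have hU : U ≠ ⊤ := by rintro rfl; rw [finrank_top] at hk; omega
    obtain ⟨c, hc, hmin⟩ := exists_min_weight ev s hU
    refine (residualSum_mono hq (hd c hc)).trans ?_
    rw [residualSum, ← card_zeros_add_weight ev s c, add_comm]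
    refine Nat.add_le_add_right ?_ _
    refine ih (U := U ⊔ F ∙ c) ?_ (zeros_vanish ev h0 c) ?_
    · rw [finrank_sup_span hc]; omega
    · intro x hx
      exact weight_zeros_of_forall_le ev rfl fun a =>
        hmin _ fun h => add_smul_notMem_sup hx a (Submodule.mem_sup_left h)

/-- A Griesmer code relative to a subspace `U` on which all coordinates vanish. -/
structure RelGriesmer (U : Submodule F V) (s : Finset ι) (d : ℕ) : Prop where
  pos : 0 < d
  vanish : ∀ i ∈ s, ∀ x ∈ U, ev i x = 0
  le_weight : ∀ x ∉ U, d ≤ weight ev s x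
  card_eq : s.card = residualSum (Fintype.card F) (Module.finrank F V - Module.finrank F U) d

variable {ev} {U : Submodule F V} {s : Finset ι} {d : ℕ}

/-- A larger minimum weight would make the Griesmer bound exceed the length. -/
lemma RelGriesmer.exists_weight_eq (h : RelGriesmer ev U s d) (hU : U ≠ ⊤) :
    ∃ c ∉ U, weight ev s c = d := by
  have hq : 0 < Fintype.card F := Fintype.card_pos
  obtain ⟨c, hc, hmin⟩ := exists_min_weight ev s hU
  refine ⟨c, hc, ?_⟩
  have hlt := finrank_lt_of_ne_top hU
  obtain ⟨k, hk⟩ : ∃ k, Module.finrank F V - Module.finrank F U = k + 1 :=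
    ⟨Module.finrank F V - Module.finrank F U - 1, by omega⟩
  have h1 := residualSum_le_card ev (k := k + 1) (by omega) h.vanish hmin
  rw [h.card_eq, hk] at h1
  by_contra hne
  have h2 := lt_of_le_of_ne (h.le_weight c hc) (Ne.symm hne)
  have h3 := residualSum_mono (k := k) hq (ceilDiv_mono hq h2.le)
  rw [residualSum, residualSum] at h1
  omega

lemma RelGriesmer.residual (h : RelGriesmer ev U s d) {c : V} (hc : c ∉ U)
    (hcd : weight ev s c = d) :
    RelGriesmer ev (U ⊔ F ∙ c) (zeros ev s c) (d ⌈/⌉ Fintype.card F) where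
  pos := by
    have h1 := le_mul_ceilDiv d (Fintype.card_pos (α := F))
    have := h.pos
    by_contra h0
    rw [Nat.eq_zero_of_not_pos h0, mul_zero] at h1
    omega
  vanish := zeros_vanish ev h.vanish c
  le_weight x hx := weight_zeros_of_forall_le ev hcd fun a =>
    h.le_weight _ fun h => add_smul_notMem_sup hx a (Submodule.mem_sup_left h)
  card_eq := by
    have hU : U ≠ ⊤ := by rintro rfl; exact hc trivial
    have hlt := finrank_lt_of_ne_top hU
    obtain ⟨k, hk⟩ : ∃ k, Module.finrank F V - Module.finrank F U = k + 1 :=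
      ⟨Module.finrank F V - Module.finrank F U - 1, by omega⟩
    have h1 := card_zeros_add_weight ev s c
    rw [h.card_eq, hk, hcd, residualSum] at h1
    rw [finrank_sup_span hc, ← Nat.sub_sub, hk, Nat.add_sub_cancel]
    omega

omit [Module.Finite F V] in
-- For `q ∣ d` the total weight along the line is exactly `q * d`, so no word on it exceeds the
-- minimum. This provides the lines for polarization.
lemma RelGriesmer.weight_lift_of_dvd (h : RelGriesmer ev U s d) {b c : V}
    (hcd : weight ev s c = d) (hb : b ∉ U ⊔ F ∙ c)
    (hbd : weight ev (zeros ev s c) b = d ⌈/⌉ Fintype.card F) (hd : Fintype.card F ∣ d) (a : F) :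
    weight ev s (b + a • c) = d := by
  have hq : 0 < Fintype.card F := Fintype.card_pos
  have h1 := sum_weight_line ev s b c
  have h2 : ∀ a ∈ (Finset.univ : Finset F), d ≤ weight ev s (b + a • c) := fun a _ =>
    h.le_weight _ fun h => add_smul_notMem_sup hb a (Submodule.mem_sup_left h)
  refine ((Finset.sum_eq_sum_iff_of_le h2).1 ?_ a (Finset.mem_univ a)).symm
  rw [h1, hcd, hbd, Finset.sum_const, Finset.card_univ, smul_eq_mul]
  rw [mul_ceilDiv_of_dvd hq hd, Nat.sub_mul, one_mul]
  exact (Nat.sub_add_cancel (Nat.le_mul_of_pos_left d hq)).symm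

omit [Module.Finite F V] in
-- Without divisibility the total weight along the line is still less than `q * (d + 1)`.
lemma RelGriesmer.exists_lift (h : RelGriesmer ev U s d) {b c : V}
    (hcd : weight ev s c = d) (hb : b ∉ U ⊔ F ∙ c)
    (hbd : weight ev (zeros ev s c) b = d ⌈/⌉ Fintype.card F) :
    ∃ a : F, weight ev s (b + a • c) = d := by
  have hq : 0 < Fintype.card F := Fintype.card_pos
  have h1 := sum_weight_line ev s b c
  have h2 : ∀ a : F, d ≤ weight ev s (b + a • c) := fun a =>
    h.le_weight _ fun h => add_smul_notMem_sup hb a (Submodule.mem_sup_left h)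
  by_contra hne
  push Not at hne
  have h3 : ∑ _a : F, (d + 1) ≤ ∑ a : F, weight ev s (b + a • c) :=
    Finset.sum_le_sum fun a _ => lt_of_le_of_ne (h2 a) (hne a).symm
  rw [h1, hcd, hbd, Finset.sum_const, Finset.card_univ, smul_eq_mul] at h3
  have h4 := mul_ceilDiv_lt d hq
  obtain ⟨n, hn⟩ : ∃ n, Fintype.card F = n + 1 := ⟨Fintype.card F - 1, by omega⟩
  rw [hn, Nat.add_sub_cancel] at h3
  rw [hn] at h4
  linarith

/-- Minimum weight words span. -/
lemma RelGriesmer.span_sup_eq_top (h : RelGriesmer ev U s d) :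
    Submodule.span F {c | c ∉ U ∧ weight ev s c = d} ⊔ U = ⊤ := by
  induction hk : Module.finrank F V - Module.finrank F U generalizing U s d with
  | zero =>
    by_cases hU : U = ⊤
    · simp [hU]
    · have := finrank_lt_of_ne_top hU; omega
  | succ k ih =>
    have hU : U ≠ ⊤ := by rintro rfl; rw [finrank_top] at hk; omega
    obtain ⟨c, hc, hcd⟩ := h.exists_weight_eq hU
    have h1 := ih (h.residual hc hcd) (by rw [finrank_sup_span hc]; omega)
    rw [eq_top_iff, ← h1, sup_le_iff, sup_le_iff, Submodule.span_singleton_le_iff_mem,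
      Submodule.span_le]
    have hcm : c ∈ Submodule.span F {c | c ∉ U ∧ weight ev s c = d} :=
      Submodule.subset_span ⟨hc, hcd⟩
    refine ⟨?_, le_sup_right, Submodule.mem_sup_left hcm⟩
    rintro b ⟨hb, hbd⟩
    obtain ⟨a, ha⟩ := h.exists_lift hcd hb hbd
    have h2 : b + a • c ∈ Submodule.span F {c | c ∉ U ∧ weight ev s c = d} :=
      Submodule.subset_span ⟨fun h => add_smul_notMem_sup hb a (Submodule.mem_sup_left h), ha⟩
    refine Submodule.mem_sup_left ?_
    simpa using sub_mem h2 (Submodule.smul_mem _ a hcm)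

end Relative

lemma Multiset.exists_le_map_eq {α β : Type*} [DecidableEq β] (g : α → β) {Y : Multiset α}
    {Z : Multiset β} (h : Z ≤ Y.map g) : ∃ Y' ≤ Y, Y'.map g = Z := by
  induction Y using Multiset.induction_on generalizing Z with
  | empty =>
    refine ⟨0, le_rfl, ?_⟩
    rw [Multiset.map_zero] at h ⊢
    exact (Multiset.le_zero.1 h).symm
  | cons a Y ih =>
    rw [Multiset.map_cons] at h
    by_cases ha : g a ∈ Z
    · obtain ⟨Z', rfl⟩ := Multiset.exists_cons_of_mem ha
      obtain ⟨Y', h1, rfl⟩ := ih ((Multiset.cons_le_cons_iff _).1 h)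
      exact ⟨a ::ₘ Y', Multiset.cons_le_cons _ h1, by simp⟩
    · obtain ⟨Y', h1, rfl⟩ := ih ((Multiset.le_cons_of_notMem ha).1 h)
      exact ⟨Y', h1.trans (Multiset.le_cons_self _ _), rfl⟩

/-! ### Descent along a flag of residual codes. -/

namespace GroupAlg

section Flag

variable {F : Type*} [Field F] [Fintype F] [DecidableEq F] {V : Type*} [AddCommGroup V] [Module F V]
variable (p : ℕ)

/-- The subalgebra of elements supported on a subspace. -/
noncomputable def supportedOn (U : Submodule F V) : Subalgebra F (AddMonoidAlgebra F V) :=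
  (push F U.subtype.toAddMonoidHom).range

omit [Fintype F] [DecidableEq F] in
lemma pt_mem_supportedOn {U : Submodule F V} {x : V} (hx : x ∈ U) : pt F x ∈ supportedOn U :=
  ⟨pt F ⟨x, hx⟩, by simp [push_pt]⟩

lemma slot_mem_supportedOn {U : Submodule F V} {x : V} (hx : x ∈ U) (j : ℕ) :
    slot F p x j ∈ supportedOn U :=
  Subalgebra.sum_mem _ fun _ _ => Subalgebra.smul_mem _
    (Subalgebra.sub_mem _ (pt_mem_supportedOn (U.smul_mem _ hx)) (Subalgebra.one_mem _)) _

omit [Fintype F] [DecidableEq F] in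
lemma supportedOn_mono {U U' : Submodule F V} (h : U ≤ U') : supportedOn U ≤ supportedOn U' := by
  rintro _ ⟨r, rfl⟩
  induction r using alg_induction with
  | h0 => simp
  | hadd a b ha hb => rw [map_add]; exact Subalgebra.add_mem _ ha hb
  | hpt c g =>
    change push F _ (c • pt F g) ∈ _
    rw [map_smul]
    refine Subalgebra.smul_mem _ ?_ _
    have := pt_mem_supportedOn (h g.2)
    simpa [push_pt] using this

omit [Fintype F] [DecidableEq F] in
lemma lext_eq_zero_of_supportedOn {U : Submodule F V} {u : V → F} (hu : ∀ x ∈ U, u x = 0)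
    {r : AddMonoidAlgebra F V} (hr : r ∈ supportedOn U) : lext u r = 0 := by
  obtain ⟨r, rfl⟩ := hr
  have h := lext_push U.subtype.toAddMonoidHom u r
  refine h.trans ?_
  have : (u ∘ U.subtype.toAddMonoidHom) = fun x => (0 : F) * (0 : F) := by
    funext x; simpa using hu x x.2
  rw [this, lext_smul]; simp

variable [Module.Finite F V] {ι : Type*} {ev : ι → V →ₗ[F] F}

omit [Module.Finite F V] [Fintype F] in
lemma eq_zero_on_sup_span {U : Submodule F V} {s : Finset ι} {d : ℕ} {u : V → F}
    (h0 : ∀ i ∈ s, ∀ x ∈ U, ev i x = 0) (hu0 : ∀ x ∈ U, u x = 0)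
    (hu : ∀ x ∉ U, weight ev s x = d → u x = 0) {c : V} (hc : c ∉ U) (hcd : weight ev s c = d) :
    ∀ x ∈ U ⊔ F ∙ c, u x = 0 := by
  intro x hx
  obtain ⟨y, hy, z, hz, rfl⟩ := Submodule.mem_sup.1 hx
  obtain ⟨a, rfl⟩ := Submodule.mem_span_singleton.1 hz
  rcases eq_or_ne a 0 with rfl | ha
  · simpa using hu0 y hy
  · apply hu
    · intro h
      have h1 : a • c ∈ U := by simpa using sub_mem h hy
      exact hc ((Submodule.smul_mem_iff _ ha).1 h1)
    · rw [weight_add_of_forall_eq_zero ev fun i hi => h0 i hi y hy, weight_smul ev s ha, hcd]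

/-- `w` collects the factors already specialized to words of `U`, and `h` counts the remaining
residual steps. Each step takes up to `p - 1` factors of every type, specializes them to a word `c`
of weight `d`, and passes to `U ⊔ F ∙ c` and `d / q`. Hypothesis `hS` says that a further factor
from `U`, of a type still present in `Y`, gains an extra degree; it persists since such a type has
already used `p - 1` factors at `c`, and `p`-th powers of slots vanish. -/
lemma lext_slotProd_mul_eq_zero [hp : Fact p.Prime] [CharP F p] {f : ℕ}
    (hq : Fintype.card F = p ^ f) (u : V → F) (m : ℕ)
    (hΛ : ∀ r ∈ augIdeal F V ^ (m + 1), lext u r = 0) (h : ℕ) (U : Submodule F V) (s : Finset ι)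
    (d : ℕ) (hG : RelGriesmer ev U s d) (hd : Fintype.card F ^ h ∣ d) (hu0 : ∀ x ∈ U, u x = 0)
    (hu : ∀ x ∉ U, weight ev s x = d → u x = 0) (Y : Multiset (V × Fin f))
    (w : AddMonoidAlgebra F V) (l : ℕ) (hw : w ∈ augIdeal F V ^ l) (hwU : w ∈ supportedOn U)
    (hm : Y.card + l = m)
    (hY : ∑ j, ((Y.map Prod.snd).count j - h * (p - 1)) ≤ 1)
    (hS : ∀ j ∈ Y.map Prod.snd, ∀ b ∈ U, slot F p b j * w ∈ augIdeal F V ^ (l + 2)) :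
    lext u (slotProd F p Y * w) = 0 := by
  induction h generalizing U s d Y w l with
  | zero =>
    have hcard : Y.card ≤ 1 := by
      simp only [zero_mul, Nat.sub_zero] at hY
      rwa [Multiset.sum_count_eq_card fun _ _ => Finset.mem_univ _, Multiset.card_map] at hY
    rcases Nat.le_one_iff_eq_zero_or_eq_one.1 hcard with h0 | h1
    · rw [Multiset.card_eq_zero.1 h0]
      simpa [slotProd] using lext_eq_zero_of_supportedOn hu0 hwU
    · obtain ⟨⟨y, j⟩, rfl⟩ := Multiset.card_eq_one.1 h1
      rw [h1] at hm
      have hspan : y ∈ Submodule.span F ({c | c ∉ U ∧ weight ev s c = d} ∪ U) := by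
        rw [Submodule.span_union, Submodule.span_eq, hG.span_sup_eq_top]; trivial
      have := slot_mul_eq_zero_of_mem_span p (lext u) (n := l)
        (fun r hr => hΛ r (by rwa [show m + 1 = l + 2 by omega])) hw j
        (X := {c | c ∉ U ∧ weight ev s c = d} ∪ U) ?_ hspan
      · simpa [slotProd] using this
      · rintro x (⟨hx, hxd⟩ | hx)
        · exact lext_eq_zero_of_supportedOn (eq_zero_on_sup_span hG.vanish hu0 hu hx hxd)
            (Subalgebra.mul_mem _ (slot_mem_supportedOn p
              (Submodule.mem_sup_right (Submodule.mem_span_singleton_self x)) _)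
              (supportedOn_mono le_sup_left hwU))
        · exact lext_eq_zero_of_supportedOn hu0
            (Subalgebra.mul_mem _ (slot_mem_supportedOn p hx _) hwU)
  | succ h ih =>
    by_cases hUtop : U = ⊤
    · refine lext_eq_zero_of_supportedOn (U := ⊤) (fun x _ => hu0 x (by rw [hUtop]; trivial)) ?_
      refine Subalgebra.mul_mem _ ?_ (supportedOn_mono le_top hwU)
      exact Subalgebra.multiset_prod_mem _ fun r hr => by
        obtain ⟨z, -, rfl⟩ := Multiset.mem_map.1 hr
        exact slot_mem_supportedOn p Submodule.mem_top _
    have hqpos : 0 < Fintype.card F := Fintype.card_pos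
    have hqd : Fintype.card F ∣ d := (dvd_pow_self _ (Nat.succ_ne_zero h)).trans hd
    -- The types to specialize now, each with multiplicity truncated at `p - 1`; `Y₁` realizes them
    -- and `Y₂` is the rest.
    set Z := (Y.map Prod.snd) ∩ ((p - 1) • (Finset.univ : Finset (Fin f)).val) with hZ
    have hZc : ∀ j, Z.count j = min ((Y.map Prod.snd).count j) (p - 1) := fun j => by
      rw [hZ, Multiset.count_inter, Multiset.count_nsmul, Multiset.count_univ, mul_one]
    obtain ⟨Y₁, hY₁, hY₁Z⟩ := Multiset.exists_le_map_eq Prod.snd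
      (show Z ≤ Y.map Prod.snd from Multiset.inter_le_left)
    obtain ⟨Y₂, rfl⟩ := Multiset.le_iff_exists_add.1 hY₁
    have hc₂ : ∀ j, (Y₂.map Prod.snd).count j =
        ((Y₁ + Y₂).map Prod.snd).count j - (p - 1) := by
      intro j
      have h1 := hZc j
      rw [← hY₁Z] at h1
      rw [Multiset.map_add, Multiset.count_add] at h1 ⊢
      omega
    have hprod : ∀ (Y₁ Y₂ : Multiset (V × Fin f)),
        slotProd F p (Y₁ + Y₂) = slotProd F p Y₁ * slotProd F p Y₂ := fun _ _ => by
      simp [slotProd]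
    rw [hprod, mul_assoc]
    rw [Multiset.card_add] at hm
    refine eq_zero_of_diagonal p hq (lext u) m hΛ {c | c ∉ U ∧ weight ev s c = d}
      (hG.exists_weight_eq hUtop) (fun c => {b | b ∉ U ⊔ F ∙ c ∧
        weight ev (zeros ev s c) b = d ⌈/⌉ Fintype.card F}) U ?_ ?_ Y₁ _ (Y₂.card + l) ?_
        (by omega) ?_ ?_ ?_
    · rintro c ⟨hc, hcd⟩ b ⟨hb, hbd⟩ a
      rcases eq_or_ne a 0 with rfl | ha
      · simpa using ⟨hc, hcd⟩
      -- Up to a scalar, the line through `c` in direction `b` is the line of lifts of the residual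
      -- word `b`.
      · have h1 : c + a • b = a • (b + a⁻¹ • c) := by
          rw [smul_add, smul_smul, mul_inv_cancel₀ ha, one_smul, add_comm]
        rw [h1]
        refine ⟨fun h2 => ?_, ?_⟩
        · rw [Submodule.smul_mem_iff _ ha] at h2
          exact add_smul_notMem_sup hb a⁻¹ (Submodule.mem_sup_left h2)
        · rw [weight_smul ev s ha, hG.weight_lift_of_dvd hcd hb hbd hqd]
    · rintro c ⟨hc, hcd⟩
      rw [Set.union_assoc, Submodule.span_union, Submodule.span_union, Submodule.span_eq,
        sup_comm (F ∙ c)]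
      exact (hG.residual hc hcd).span_sup_eq_top
    · rw [pow_add]; exact Ideal.mul_mem_mul (slotProd_mem p _) hw
    · intro j
      rw [hY₁Z, hZc]; exact min_le_right _ _
    · intro j hj b hb
      rw [mul_left_comm, add_assoc, pow_add]
      refine Ideal.mul_mem_mul (slotProd_mem p _) (hS j ?_ b hb)
      rw [Multiset.map_add]; exact Multiset.mem_add.2 (Or.inl hj)
    · rintro c ⟨hc, hcd⟩
      have hcU : c ∈ U ⊔ F ∙ c := Submodule.mem_sup_right (Submodule.mem_span_singleton_self c)
      have hpow : (∏ j : Fin f, slot F p c j ^ (Y₁.map Prod.snd).count j) ∈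
          augIdeal F V ^ Y₁.card := by
        have h1 : ∑ i, (Y₁.map Prod.snd).count i = Y₁.card := by
          rw [← Multiset.card_map (Prod.snd : V × Fin f → Fin f)]
          exact Multiset.sum_count_eq_card fun _ _ => Finset.mem_univ _
        rw [← h1, ← Finset.prod_pow_eq_pow_sum]
        exact Ideal.prod_mem_prod fun i _ => Ideal.pow_mem_pow (slot_mem p _ _) _
      rw [mul_left_comm]
      refine ih (U ⊔ F ∙ c) (zeros ev s c) (d ⌈/⌉ Fintype.card F) (hG.residual hc hcd) ?_
        (eq_zero_on_sup_span hG.vanish hu0 hu hc hcd) ?_ Y₂ _ (Y₁.card + l) ?_ ?_ (by omega) ?_ ?_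
      · rw [← mul_ceilDiv_of_dvd hqpos hqd, pow_succ'] at hd
        exact Nat.dvd_of_mul_dvd_mul_left hqpos hd
      · intro x hx hxd
        have := hG.weight_lift_of_dvd hcd hx hxd hqd 0
        rw [zero_smul, add_zero] at this
        exact hu x (fun h => hx (Submodule.mem_sup_left h)) this
      · rw [pow_add]; exact Ideal.mul_mem_mul hpow hw
      · refine Subalgebra.mul_mem _ ?_ (supportedOn_mono le_sup_left hwU)
        exact Subalgebra.prod_mem _ fun j _ => Subalgebra.pow_mem _ (slot_mem_supportedOn p hcU _) _
      · refine le_trans (Finset.sum_le_sum fun j _ => ?_) hY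
        rw [hc₂ j, add_mul]; omega
      · intro j hj b hb
        have hj' : j ∈ (Y₁ + Y₂).map Prod.snd := by
          rw [Multiset.map_add]; exact Multiset.mem_add.2 (Or.inr hj)
        obtain ⟨b, hb', z, hz, rfl⟩ := Submodule.mem_sup.1 hb
        obtain ⟨a, rfl⟩ := Submodule.mem_span_singleton.1 hz
        set π := (∏ j : Fin f, slot F p c j ^ (Y₁.map Prod.snd).count j) with hπ
        have h1 : slot F p b j * (π * w) ∈ augIdeal F V ^ (Y₁.card + l + 2) := by
          rw [mul_left_comm, add_assoc, pow_add]
          exact Ideal.mul_mem_mul hpow (hS j hj' b hb')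
        have h2 : slot F p c j * π = 0 := by
          have h3 : (Y₁.map Prod.snd).count j = p - 1 := by
            have h4 := Multiset.count_pos.2 hj
            rw [hc₂ j] at h4
            rw [hY₁Z, hZc j]
            omega
          rw [hπ, ← Finset.mul_prod_erase _ _ (Finset.mem_univ j), ← mul_assoc, h3, ← pow_succ',
            Nat.sub_add_cancel hp.out.one_le, slot_pow, zero_mul]
        have h3 : slot F p (b + a • c) j * (π * w) =
            (slot F p (b + a • c) j - (slot F p b j + slot F p (a • c) j)) * (π * w) +
              slot F p b j * (π * w) + slot F p (a • c) j * π * w := by ring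
        rw [h3, slot_smul p a c, smul_mul_assoc, h2, smul_zero, zero_mul, add_zero]
        refine add_mem ?_ h1
        rw [add_comm _ 2, pow_add, pow_add]
        rw [← slot_smul]
        exact Ideal.mul_mem_mul (slot_add p _ _ _) (Ideal.mul_mem_mul hpow hw)

/-- Vanishing of a function of low degree on a Griesmer code, from its vanishing at the words of
minimum weight. -/
lemma eq_zero_of_min_weight [hp : Fact p.Prime] [CharP F p] {f e : ℕ}
    (hf : 0 < f) (he : 0 < e) (hef : e ≤ 2 ∨ f = 1)
    (hq : Fintype.card F = p ^ f) (u : V → F) (hus : ∀ (a : Fˣ) x, u ((a : F) • x) = u x)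
    (hΛ : ∀ r ∈ augIdeal F V ^ ((e + f - 1) * (p - 1) + 1), lext u r = 0) (s : Finset ι)
    (d : ℕ) (hG : RelGriesmer ev ⊥ s d) (hd : Fintype.card F ^ e ∣ d) (hu0 : u 0 = 0)
    (hu : ∀ x, weight ev s x = d → u x = 0) : u = 0 := by
  have hp2 := hp.out.two_le
  -- Descend to `augIdeal ^ 1`; there the vanishing says that `u` is constant.
  have key : ∀ i ≤ (e + f - 1) * (p - 1),
      ∀ r ∈ augIdeal F V ^ ((e + f - 1) * (p - 1) - i + 1), lext u r = 0 := by
    intro i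
    induction i with
    | zero => intro _; exact hΛ
    | succ i ih =>
      intro hi
      have h1 := ih (by omega)
      set m := (e + f - 1) * (p - 1) - i with hm
      rw [show (e + f - 1) * (p - 1) - (i + 1) + 1 = m by omega]
      refine eq_zero_on_pow_of_slotProd p hf hq (lext u) m h1 fun Y hY => ?_
      by_cases hdvd : p ^ f - 1 ∣ (Y.map fun z => p ^ (z.2 : ℕ)).sum
      · have hsum : (Y.map fun z => p ^ (z.2 : ℕ)).sum =
            ∑ j, (Y.map Prod.snd).count j * p ^ (j : ℕ) := by
          have h2 : (Y.map fun z => p ^ (z.2 : ℕ)).sum =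
              ((Y.map Prod.snd).map fun j : Fin f => p ^ (j : ℕ)).sum := by
            rw [Multiset.map_map]; rfl
          rw [h2, Finset.sum_multiset_map_count]
          refine Finset.sum_subset (Finset.subset_univ _) ?_
          intro j _ hj
          rw [Multiset.mem_toFinset, ← Multiset.count_eq_zero] at hj
          simp [hj]
        have hcard : ∑ j, (Y.map Prod.snd).count j = m := by
          rw [Multiset.sum_count_eq_card fun _ _ => Finset.mem_univ _, Multiset.card_map, hY]
        have hex := sum_digit_excess_le_one p hp2 hf e he hef
          (fun j => (Y.map Prod.snd).count j) (hsum ▸ hdvd) (by rw [hcard]; omega)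
        have := lext_slotProd_mul_eq_zero p hq u m h1 e ⊥ s d hG hd (by simpa using hu0)
          (fun x _ => hu x) Y 1 0 (by simp) (Subalgebra.one_mem _) (by omega) hex ?_
        · simpa using this
        · rintro j - b hb
          rw [(Submodule.mem_bot F).1 hb]
          simp [slot, dl_zero]
      · exact lext_slotProd_eq_zero p hq u hus Y hdvd
  funext x
  have h1 := key _ le_rfl (dl F x) (by simpa using dl_mem x)
  have h2 : pt F x = dl F x + pt F 0 := by rw [dl, pt_zero]; ring
  have h3 := congrArg (lext u) h2
  rw [map_add, h1, lext_pt, lext_pt, hu0, add_zero] at h3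
  exact h3

end Flag

end GroupAlg

/-! ### Numerical estimates. -/

section Numeric

lemma sum_range_pow_sub (q K : ℕ) :
    ∑ i ∈ Finset.range (K + 1), q ^ (K - i) = ∑ i ∈ Finset.range (K + 1), q ^ i := by
  rw [← Finset.sum_range_reflect]
  refine Finset.sum_congr rfl fun i hi => ?_
  rw [Finset.mem_range] at hi
  congr 1; omega

/-- No quotient is rounded up, so the sum is geometric. -/
lemma mul_residualSum_of_dvd {q e K d : ℕ} (hq : 0 < q) (hd : q ^ e ∣ d) (hK : K ≤ e) :
    (q - 1) * q ^ K * residualSum q (K + 1) d + d = d * q ^ (K + 1) := by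
  have h1 : q ^ K * residualSum q (K + 1) d = d * ∑ i ∈ Finset.range (K + 1), q ^ i := by
    rw [residualSum_eq _ _ _ hq, ← sum_range_pow_sub, Finset.mul_sum, Finset.mul_sum]
    refine Finset.sum_congr rfl fun i hi => ?_
    have hi' : i ≤ K := by rw [Finset.mem_range] at hi; omega
    have h2 := mul_ceilDiv_of_dvd (show 0 < q ^ i by positivity)
      ((pow_dvd_pow q (hi'.trans hK)).trans hd)
    calc q ^ K * (d ⌈/⌉ q ^ i) = q ^ (K - i) * (q ^ i * (d ⌈/⌉ q ^ i)) := by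
          rw [← mul_assoc, ← pow_add, Nat.sub_add_cancel hi']
      _ = d * q ^ (K - i) := by rw [h2, mul_comm]
  rw [mul_assoc, h1, ← sub_one_mul_geom_sum hq (K + 1)]
  ring

/-- With `τ = ⌈d / q ^ K⌉ - 1`, both `d` and `τ * q ^ K < d` are multiples of `q ^ e`, so they
differ by at least `q ^ e`. Dividing by each `q ^ i` and summing gives two geometric series. -/
lemma le_mul_residualSum {q e K d : ℕ} (hq : 0 < q) (hd0 : 0 < d) (hd : q ^ e ∣ d) (hK : e ≤ K) :
    (d ⌈/⌉ q ^ K - 1) * (q ^ (K + 1) - 1) + (q ^ (e + 1) - 1) ≤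
      (q - 1) * residualSum q (K + 1) d := by
  have hqK : 0 < q ^ K := by positivity
  have hqe : 0 < q ^ e := by positivity
  set τ := d ⌈/⌉ q ^ K - 1 with hτ
  have h1 : τ * q ^ K + q ^ e ≤ d := by
    have h2 : q ^ K * τ < d := by
      by_contra h
      push Not at h
      have h3 := (ceilDiv_le_iff_le_mul hqK).2 h
      have h4 : 0 < d ⌈/⌉ q ^ K := by
        by_contra h0
        have := le_mul_ceilDiv d hqK
        rw [Nat.eq_zero_of_not_pos h0, mul_zero] at this
        omega
      omega
    obtain ⟨δ, rfl⟩ := hd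
    have h5 : q ^ K = q ^ e * q ^ (K - e) := by rw [← pow_add, Nat.add_sub_cancel' hK]
    rw [h5, mul_assoc] at h2
    have h6 := Nat.lt_of_mul_lt_mul_left h2
    calc τ * q ^ K + q ^ e = q ^ e * (q ^ (K - e) * τ + 1) := by rw [h5]; ring
      _ ≤ _ := Nat.mul_le_mul_left _ h6
  have h2 : ∀ i ∈ Finset.range (K + 1), τ * q ^ (K - i) + (if i < e + 1 then q ^ (e - i) else 0) ≤
      d ⌈/⌉ q ^ i := by
    intro i hi
    have hi' : i ≤ K := by rw [Finset.mem_range] at hi; omega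
    have hqi : 0 < q ^ i := by positivity
    refine Nat.le_of_mul_le_mul_left (le_trans ?_ (h1.trans (le_mul_ceilDiv d hqi))) hqi
    have h3 : q ^ i * q ^ (K - i) = q ^ K := by rw [← pow_add, Nat.add_sub_cancel' hi']
    rw [mul_add, mul_left_comm, h3]
    refine Nat.add_le_add_left ?_ _
    split_ifs with h
    · rw [← pow_add, Nat.add_sub_cancel' (by omega)]
    · simp
  have h3 := Finset.sum_le_sum h2
  rw [Finset.sum_add_distrib, ← Finset.mul_sum, sum_range_pow_sub, ← residualSum_eq _ _ _ hq] at h3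
  have h4 : ∑ i ∈ Finset.range (e + 1), q ^ i ≤
      ∑ i ∈ Finset.range (K + 1), if i < e + 1 then q ^ (e - i) else 0 := by
    rw [← sum_range_pow_sub, ← Finset.sum_filter]
    refine Finset.sum_le_sum_of_subset fun i hi => ?_
    rw [Finset.mem_range] at hi
    rw [Finset.mem_filter, Finset.mem_range]
    omega
  have h5 := Nat.mul_le_mul_left (q - 1) (le_trans (Nat.add_le_add_left h4 _) h3)
  rw [mul_add, mul_left_comm] at h5
  have h6 := sub_one_mul_geom_sum hq (K + 1)
  have h7 := sub_one_mul_geom_sum hq (e + 1)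
  rw [← h6, ← h7, Nat.add_sub_cancel, Nat.add_sub_cancel]
  exact h5

/-- The point is `e + f - 1 ≤ f * (e - 1)`, that is `(e - 2) * (f - 1) ≥ 1`; it separates the two
cases of the proof. -/
lemma sq_mul_pow_lt {p q f e : ℕ} (hp : 2 ≤ p) (hq : q = p ^ f) (hf : 2 ≤ f) (he : 3 ≤ e) :
    (q - 1) ^ 2 * p ^ (e + f - 1) < q ^ (e + 1) - 1 := by
  have h1 : p ^ (e + f - 1) ≤ q ^ (e - 1) := by
    rw [hq, ← pow_mul]
    refine Nat.pow_le_pow_right (by omega) ?_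
    obtain ⟨a, rfl⟩ : ∃ a, e = a + 3 := ⟨e - 3, by omega⟩
    obtain ⟨b, rfl⟩ : ∃ b, f = b + 2 := ⟨f - 2, by omega⟩
    have : a + 3 - 1 = a + 2 := by omega
    rw [this]
    have : a + 3 + (b + 2) - 1 = a + b + 4 := by omega
    rw [this]
    nlinarith [Nat.zero_le (a * b)]
  have hq2 : 2 ≤ q := by
    rw [hq]
    calc 2 ≤ p := hp
      _ = p ^ 1 := (pow_one p).symm
      _ ≤ p ^ f := Nat.pow_le_pow_right (by omega) (by omega)
  obtain ⟨a, rfl⟩ : ∃ a, e = a + 3 := ⟨e - 3, by omega⟩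
  obtain ⟨b, hb⟩ : ∃ b, q = b + 2 := ⟨q - 2, by omega⟩
  have hQ : 2 ≤ q ^ (a + 2) := hq2.trans (Nat.le_self_pow (by omega) q)
  have h2 : q ^ (a + 3 + 1) = q ^ (a + 2) * (b + 2) ^ 2 := by rw [← hb]; ring
  have h3 := Nat.mul_le_mul_left ((q - 1) ^ 2) h1
  rw [show a + 3 - 1 = a + 2 by omega] at h3
  refine lt_of_le_of_lt h3 ?_
  rw [h2]
  have h4 : q - 1 = b + 1 := by omega
  rw [h4]
  have h5 : (b + 1) ^ 2 * q ^ (a + 2) + q ^ (a + 2) ≤ q ^ (a + 2) * (b + 2) ^ 2 := by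
    have : (b + 1) ^ 2 + 1 ≤ (b + 2) ^ 2 := by nlinarith
    calc _ = q ^ (a + 2) * ((b + 1) ^ 2 + 1) := by ring
      _ ≤ _ := Nat.mul_le_mul_left _ this
  omega

end Numeric

/-! ### A second moment bound for sets avoiding hyperplanes. -/

section Density

variable {F : Type*} [Field F] [Fintype F] [DecidableEq F]

section Balanced

variable {V : Type*} [AddCommGroup V] [Module F V]

/-- The balanced indicator of the kernel of a functional. -/
def balanced (z : V →ₗ[F] F) (x : V) : ℤ := (if z x = 0 then (Fintype.card F : ℤ) else 0) - 1

lemma balanced_sq (z : V →ₗ[F] F) (x : V) :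
    balanced z x * balanced z x =
      ((Fintype.card F : ℤ) - 2) * balanced z x + ((Fintype.card F : ℤ) - 1) := by
  unfold balanced; split_ifs <;> ring

lemma sum_balanced_line (z : V →ₗ[F] F) {v : V} (hv : z v ≠ 0) (x : V) :
    ∑ a : F, balanced z (x + a • v) = 0 := by
  have h : ∀ a : F, z (x + a • v) = 0 ↔ a = -(z x) / z v := by
    intro a
    rw [map_add, map_smul, smul_eq_mul, eq_div_iff hv]
    constructor <;> intro h <;> linear_combination h
  simp only [balanced, h, Finset.sum_sub_distrib, Finset.sum_ite_eq', Finset.mem_univ, if_true]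
  simp

variable [Fintype V]

/-- Average over translates by multiples of `v`: `h` is unchanged, and `balanced z` sums to zero on
each line. -/
lemma sum_mul_balanced_eq_zero (h : V → ℤ) (z : V →ₗ[F] F) {v : V} (hv : z v ≠ 0)
    (hh : ∀ x (a : F), h (x + a • v) = h x) : ∑ x, h x * balanced z x = 0 := by
  have h1 : ∑ a : F, ∑ x, h (x + a • v) * balanced z (x + a • v) =
      (Fintype.card F : ℤ) * ∑ x, h x * balanced z x := by
    have h2 : ∀ a ∈ (Finset.univ : Finset F),
        ∑ x, h (x + a • v) * balanced z (x + a • v) = ∑ x, h x * balanced z x := fun a _ =>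
      Fintype.sum_equiv (Equiv.addRight (a • v)) _ (fun x => h x * balanced z x) fun x => rfl
    rw [Finset.sum_congr rfl h2]
    simp
  rw [Finset.sum_comm] at h1
  simp only [hh, ← Finset.mul_sum, sum_balanced_line z hv, mul_zero, Finset.sum_const_zero] at h1
  have hq : (Fintype.card F : ℤ) ≠ 0 := by exact_mod_cast Fintype.card_ne_zero
  exact (mul_eq_zero.1 h1.symm).resolve_left hq

omit [Fintype F] in
lemma exists_apply_ne_zero {z : V →ₗ[F] F} (hz : z ≠ 0) : ∃ v, z v ≠ 0 := by
  by_contra h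
  push Not at h
  exact hz (LinearMap.ext h)

lemma sum_balanced_eq_zero {z : V →ₗ[F] F} (hz : z ≠ 0) : ∑ x, balanced z x = 0 := by
  obtain ⟨v, hv⟩ := exists_apply_ne_zero hz
  simpa using sum_mul_balanced_eq_zero (fun _ => 1) z hv fun _ _ => rfl

lemma sum_balanced_sq {z : V →ₗ[F] F} (hz : z ≠ 0) :
    ∑ x, balanced z x * balanced z x = ((Fintype.card F : ℤ) - 1) * Fintype.card V := by
  simp only [balanced_sq, Finset.sum_add_distrib, ← Finset.mul_sum, sum_balanced_eq_zero hz]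
  simp
  ring

omit [Fintype F] [DecidableEq F] [Fintype V] in
lemma eq_smul_of_ker_le {z z' : V →ₗ[F] F} (h : ∀ x, z x = 0 → z' x = 0) {v : V} (hv : z v = 1) :
    z' = z' v • z := by
  ext x
  have h1 := h (x - z x • v) (by simp [hv])
  rw [map_sub, map_smul, sub_eq_zero] at h1
  rw [h1]; simp [mul_comm]

lemma sum_balanced_mul_balanced_eq_zero {z z' : V →ₗ[F] F} (h : ¬ ∀ x, z x = 0 → z' x = 0) :
    ∑ x, balanced z x * balanced z' x = 0 := by
  push Not at h
  obtain ⟨v, hv, hv'⟩ := h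
  refine sum_mul_balanced_eq_zero (balanced z) z' hv' fun x a => ?_
  simp [balanced, hv]

lemma sum_balanced_mul_balanced_of_ker_le {z z' : V →ₗ[F] F} (hz : z ≠ 0) (hz' : z' ≠ 0)
    (h : ∀ x, z x = 0 → z' x = 0) :
    ∑ x, balanced z x * balanced z' x = ((Fintype.card F : ℤ) - 1) * Fintype.card V := by
  rw [← sum_balanced_sq hz]
  obtain ⟨v, hv⟩ := exists_apply_ne_zero hz
  have h1 : z ((z v)⁻¹ • v) = 1 := by simp [hv]
  have h2 := eq_smul_of_ker_le h h1
  have h3 : z' ((z v)⁻¹ • v) ≠ 0 := fun h0 => hz' (by rw [h2, h0, zero_smul])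
  refine Finset.sum_congr rfl fun x _ => ?_
  congr 1
  unfold balanced
  rw [h2]
  simp only [LinearMap.smul_apply, smul_eq_mul, mul_eq_zero, h3, false_or]

lemma card_ker_le_le (Z : Finset (V →ₗ[F] F)) (hZ : ∀ z ∈ Z, z ≠ 0) {z : V →ₗ[F] F} (hz : z ≠ 0)
    [DecidablePred fun z' : V →ₗ[F] F => ∀ x, z x = 0 → z' x = 0] :
    (Z.filter fun z' => ∀ x, z x = 0 → z' x = 0).card ≤ Fintype.card F - 1 := by
  obtain ⟨v, hv⟩ := exists_apply_ne_zero hz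
  have h1 : z ((z v)⁻¹ • v) = 1 := by simp [hv]
  rw [← Finset.card_univ, ← Finset.card_erase_of_mem (Finset.mem_univ (0 : F))]
  refine Finset.card_le_card_of_injOn (fun z' => z' ((z v)⁻¹ • v)) ?_ ?_
  · intro z' hz'
    obtain ⟨hz1, hz2⟩ := Finset.mem_filter.1 hz'
    refine Finset.mem_coe.2 (Finset.mem_erase.2 ⟨fun h0 => hZ z' hz1 ?_, Finset.mem_univ _⟩)
    rw [eq_smul_of_ker_le hz2 h1, show z' ((z v)⁻¹ • v) = 0 from h0, zero_smul]
  · intro a ha b hb hab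
    obtain ⟨-, ha2⟩ := Finset.mem_filter.1 ha
    obtain ⟨-, hb2⟩ := Finset.mem_filter.1 hb
    rw [eq_smul_of_ker_le ha2 h1, eq_smul_of_ker_le hb2 h1]
    exact congrArg (· • z) hab

/-- A set of vectors avoiding many hyperplanes is small. -/
lemma card_mul_card_le_of_forall_ne_zero (Z : Finset (V →ₗ[F] F)) (hZ : ∀ z ∈ Z, z ≠ 0)
    (T : Finset V) (hT : ∀ x ∈ T, ∀ z ∈ Z, z x ≠ 0) :
    T.card * Z.card ≤ (Fintype.card F - 1) ^ 2 * Fintype.card V := by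
  classical
  have hq : 0 < Fintype.card F := Fintype.card_pos
  rcases Finset.eq_empty_or_nonempty Z with rfl | hne
  · simp
  -- On `T` every balanced indicator equals `-1`. In the second moment over `V`, only proportional
  -- pairs survive, at most `q - 1` for each `z`.
  have h1 : ∀ x ∈ T, (∑ z ∈ Z, balanced z x) ^ 2 = (Z.card : ℤ) ^ 2 := by
    intro x hx
    rw [Finset.sum_congr rfl fun z hz => show balanced z x = -1 by
      rw [balanced, if_neg (hT x hx z hz)]; simp]
    simp
  have h2 : (T.card : ℤ) * (Z.card : ℤ) ^ 2 ≤ ∑ x, (∑ z ∈ Z, balanced z x) ^ 2 := by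
    calc (T.card : ℤ) * (Z.card : ℤ) ^ 2 = ∑ x ∈ T, (∑ z ∈ Z, balanced z x) ^ 2 := by
          rw [Finset.sum_congr rfl h1]; simp
      _ ≤ _ := Finset.sum_le_sum_of_subset_of_nonneg (Finset.subset_univ _)
          fun _ _ _ => sq_nonneg _
  have h3 : ∑ x, (∑ z ∈ Z, balanced z x) ^ 2 =
      ∑ z ∈ Z, ∑ z' ∈ Z, ∑ x, balanced z x * balanced z' x := by
    simp only [sq, Finset.sum_mul_sum]
    rw [Finset.sum_comm]
    refine Finset.sum_congr rfl fun z _ => ?_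
    rw [Finset.sum_comm]
  have h4 : ∀ z ∈ Z, ∑ z' ∈ Z, ∑ x, balanced z x * balanced z' x ≤
      ((Fintype.card F : ℤ) - 1) * (((Fintype.card F : ℤ) - 1) * Fintype.card V) := by
    intro z hz
    have h5 : ∀ z' ∈ Z, ∑ x, balanced z x * balanced z' x =
        if ∀ x, z x = 0 → z' x = 0 then ((Fintype.card F : ℤ) - 1) * Fintype.card V else 0 := by
      intro z' hz'
      split_ifs with h
      · exact sum_balanced_mul_balanced_of_ker_le (hZ z hz) (hZ z' hz') h
      · exact sum_balanced_mul_balanced_eq_zero h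
    rw [Finset.sum_congr rfl h5, ← Finset.sum_filter, Finset.sum_const, nsmul_eq_mul]
    refine mul_le_mul_of_nonneg_right ?_ (mul_nonneg (by omega) (by positivity))
    have := card_ker_le_le Z hZ (hZ z hz)
    omega
  have h6 := h2.trans (h3.le.trans (Finset.sum_le_sum h4))
  rw [Finset.sum_const, nsmul_eq_mul] at h6
  have h7 : (0 : ℤ) < Z.card := by exact_mod_cast hne.card_pos
  have h8 : (T.card : ℤ) * Z.card ≤ ((Fintype.card F : ℤ) - 1) ^ 2 * Fintype.card V := by
    refine le_of_mul_le_mul_left ?_ h7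
    linarith
  zify
  rw [Nat.cast_sub hq]
  simpa using h8

lemma card_mul_card_ne_zero_le (z : V →ₗ[F] F) :
    Fintype.card F * (Finset.univ.filter fun x => z x ≠ 0).card ≤
      (Fintype.card F - 1) * Fintype.card V := by
  have hq : 0 < Fintype.card F := Fintype.card_pos
  rcases eq_or_ne z 0 with rfl | hz
  · simp
  · have h1 := sum_balanced_eq_zero hz
    simp only [balanced, Finset.sum_sub_distrib, ← Finset.sum_filter, Finset.sum_const] at h1
    have h2 := Finset.card_filter_add_card_filter_not (s := (Finset.univ : Finset V))
      (fun x => z x = 0)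
    simp only [nsmul_eq_mul, Finset.card_univ, mul_one] at h1 h2
    zify [hq] at h2 ⊢
    have h3 : ((Finset.univ.filter fun x => z x ≠ 0).card : ℤ) =
      Fintype.card V - (Finset.univ.filter fun x => z x = 0).card := by
      simp only [ne_eq]; linarith
    rw [h3]
    nlinarith

end Balanced

end Density

/-! ### Griesmer subcodes on hyperplanes. -/

section Hyperplanes

open Module

variable {F : Type*} [Field F] [Fintype F] [DecidableEq F] {V : Type*} [AddCommGroup V] [Module F V]
  [Module.Finite F V] {ι : Type*} {ev : ι → V →ₗ[F] F} {s : Finset ι} {d : ℕ}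

omit [Module.Finite F V] in
lemma card_mul_sum_weight_le [Fintype V] (ev : ι → V →ₗ[F] F) (s : Finset ι) :
    Fintype.card F * ∑ x, weight ev s x ≤ s.card * ((Fintype.card F - 1) * Fintype.card V) := by
  have h1 : ∑ x, weight ev s x = ∑ i ∈ s, (Finset.univ.filter fun x => ev i x ≠ 0).card := by
    simp only [weight, Finset.card_filter]
    exact Finset.sum_comm
  rw [h1, Finset.mul_sum, ← smul_eq_mul (s.card), ← Finset.sum_const]
  exact Finset.sum_le_sum fun i _ => card_mul_card_ne_zero_le (ev i)

/-- A Griesmer code of small dimension and highly divisible minimum weight has constant weight. -/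
lemma RelGriesmer.weight_eq_of_finrank_le (h : RelGriesmer ev ⊥ s d) {e : ℕ}
    (hd : Fintype.card F ^ e ∣ d) (hk : finrank F V ≤ e + 1) {x : V} (hx : x ≠ 0) :
    weight ev s x = d := by
  classical
  have : Finite V := Module.finite_of_finite F
  let _ : Fintype V := Fintype.ofFinite V
  have hq : 0 < Fintype.card F := Fintype.card_pos
  obtain ⟨K, hK⟩ : ∃ K, finrank F V = K + 1 :=
    ⟨finrank F V - 1, by
      have := (Module.finrank_pos_iff_exists_ne_zero (R := F) (M := V)).2 ⟨x, hx⟩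
      omega⟩
  have hcard : Fintype.card V = Fintype.card F ^ (K + 1) := by
    rw [← hK]; exact Module.card_eq_pow_finrank
  have hle : ∀ y ∈ Finset.univ.erase (0 : V), d ≤ weight ev s y := fun y hy =>
    h.le_weight y (by simpa using Finset.ne_of_mem_erase hy)
  by_contra hne
  have h1 := Finset.sum_lt_sum hle ⟨x, Finset.mem_erase.2 ⟨hx, Finset.mem_univ _⟩,
    lt_of_le_of_ne (h.le_weight x (by simpa using hx)) (Ne.symm hne)⟩
  have h2 : ∑ y ∈ Finset.univ.erase (0 : V), weight ev s y ≤ ∑ y, weight ev s y :=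
    Finset.sum_le_sum_of_subset (Finset.erase_subset _ _)
  rw [Finset.sum_const, Finset.card_erase_of_mem (Finset.mem_univ _), Finset.card_univ, hcard,
    smul_eq_mul] at h1
  have h3 := card_mul_sum_weight_le ev s
  -- Here `(q - 1) * q ^ K * n = d * (q ^ (K + 1) - 1)`, so nonzero words have average weight at
  -- most `d`.
  have h4 := mul_residualSum_of_dvd hq hd (show K ≤ e by omega)
  rw [hcard, pow_succ'] at h3
  have h5 : ∑ y, weight ev s y ≤ (Fintype.card F - 1) * Fintype.card F ^ K * s.card := by
    refine Nat.le_of_mul_le_mul_left (h3.trans (le_of_eq ?_)) hq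
    ring
  rw [h.card_eq, finrank_bot, Nat.sub_zero, hK] at h5
  have h6 : 0 < Fintype.card F ^ (K + 1) := by positivity
  rw [Nat.sub_mul, one_mul, mul_comm _ d] at h1
  omega

open Classical in
/-- The coordinates in `s` vanishing on the kernel of `z`. -/
noncomputable def vanishing (ev : ι → V →ₗ[F] F) (s : Finset ι) (z : V →ₗ[F] F) : Finset ι :=
  s.filter fun i => ∀ x, z x = 0 → ev i x = 0

omit [Fintype F] [Module.Finite F V] in
open Classical in
lemma weight_ker (ev : ι → V →ₗ[F] F) (s : Finset ι) (z : V →ₗ[F] F) (y : LinearMap.ker z) :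
    weight (fun i => (ev i).comp (LinearMap.ker z).subtype)
      (s.filter fun i => ¬ ∀ x, z x = 0 → ev i x = 0) y = weight ev s y := by
  unfold weight
  congr 1
  ext i
  rw [Finset.mem_filter, Finset.mem_filter, Finset.mem_filter]
  exact ⟨fun h => ⟨h.1.1, h.2⟩, fun h => ⟨⟨h.1, fun h' => h.2 (h' y y.2)⟩, h.2⟩⟩

omit [Fintype F] [DecidableEq F] [Module.Finite F V] in
open Classical in
lemma card_vanishing_add (ev : ι → V →ₗ[F] F) (s : Finset ι) (z : V →ₗ[F] F) :
    (vanishing ev s z).card + (s.filter fun i => ¬ ∀ x, z x = 0 → ev i x = 0).card = s.card :=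
  Finset.card_filter_add_card_filter_not _

omit [Fintype F] [DecidableEq F] in
lemma finrank_ker_of_ne_zero {z : V →ₗ[F] F} (hz : z ≠ 0) {K : ℕ} (hK : finrank F V = K + 1) :
    finrank F (LinearMap.ker z) = K := by
  have := Module.Dual.finrank_ker_add_one_of_ne_zero (f := z) hz
  omega

lemma residualSum_succ (q k d : ℕ) (hq : 0 < q) :
    residualSum q (k + 1) d = residualSum q k d + d ⌈/⌉ q ^ k := by
  rw [residualSum_eq _ _ _ hq, residualSum_eq _ _ _ hq, Finset.sum_range_succ]

/-- The other coordinates carry all the weight on `ker z`, so the Griesmer bound in dimension `K`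
applies to them. Equality makes the restricted code Griesmer. -/
lemma RelGriesmer.card_vanishing_le (h : RelGriesmer ev ⊥ s d) {K : ℕ} (hK : finrank F V = K + 1)
    {z : V →ₗ[F] F} (hz : z ≠ 0) : (vanishing ev s z).card ≤ d ⌈/⌉ Fintype.card F ^ K := by
  classical
  have h1 := residualSum_le_card (fun i => (ev i).comp (LinearMap.ker z).subtype) (U := ⊥) (k := K)
    (s := s.filter fun i => ¬ ∀ x, z x = 0 → ev i x = 0) (d := d)
    (by rw [finrank_bot, finrank_ker_of_ne_zero hz hK, zero_add])
    (fun i _ x hx => by rw [(Submodule.mem_bot F).1 hx, map_zero])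
    (fun x hx => by
      rw [weight_ker]
      exact h.le_weight _ (by simpa using hx))
  have h2 := card_vanishing_add ev s z
  rw [h.card_eq, finrank_bot, Nat.sub_zero, hK, residualSum_succ _ _ _ Fintype.card_pos] at h2
  omega

open Classical in
lemma RelGriesmer.restrict_ker (h : RelGriesmer ev ⊥ s d) {K : ℕ} (hK : finrank F V = K + 1)
    {z : V →ₗ[F] F} (hz : z ≠ 0) (hc : (vanishing ev s z).card = d ⌈/⌉ Fintype.card F ^ K) :
    RelGriesmer (fun i => (ev i).comp (LinearMap.ker z).subtype) ⊥
      (s.filter fun i => ¬ ∀ x, z x = 0 → ev i x = 0) d where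
  pos := h.pos
  vanish i _ x hx := by rw [(Submodule.mem_bot F).1 hx, map_zero]
  le_weight x hx := by
    rw [weight_ker]
    exact h.le_weight _ (by simpa using hx)
  card_eq := by
    have h2 := card_vanishing_add ev s z
    rw [h.card_eq, finrank_bot, Nat.sub_zero, hK, residualSum_succ _ _ _ Fintype.card_pos] at h2
    rw [finrank_bot, finrank_ker_of_ne_zero hz hK, Nat.sub_zero]
    omega

omit [Module.Finite F V] in
-- Double counting: coordinate `i` is counted by the `q - 1` nonzero multiples of `ev i`, or of any
-- nonzero functional if `ev i = 0`.
lemma mul_card_le_sum_card_vanishing [Fintype (V →ₗ[F] F)] [DecidableEq (V →ₗ[F] F)]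
    (ev : ι → V →ₗ[F] F) (s : Finset ι) (hV : 0 < finrank F V) :
    s.card * (Fintype.card F - 1) ≤
      ∑ z ∈ Finset.univ.erase (0 : V →ₗ[F] F), (vanishing ev s z).card := by
  classical
  simp only [vanishing, Finset.card_filter]
  rw [Finset.sum_comm, ← smul_eq_mul, ← Finset.sum_const]
  refine Finset.sum_le_sum fun i _ => ?_
  rw [← Finset.card_filter]
  obtain ⟨y, hy, hyi⟩ : ∃ y : V →ₗ[F] F, y ≠ 0 ∧ ∀ x, y x = 0 → ev i x = 0 := by
    by_cases hi : ev i = 0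
    · have : Nontrivial (V →ₗ[F] F) := by
        refine Module.nontrivial_of_finrank_pos (R := F) ?_
        have h2 : finrank F (Module.Dual F V) = finrank F V := Subspace.dual_finrank_eq
        exact lt_of_lt_of_eq hV h2.symm
      obtain ⟨y, hy⟩ := exists_ne (0 : V →ₗ[F] F)
      exact ⟨y, hy, fun x _ => by rw [hi]; rfl⟩
    · exact ⟨ev i, hi, fun x h => h⟩
  rw [← Finset.card_univ, ← Finset.card_erase_of_mem (Finset.mem_univ (0 : F))]
  refine Finset.card_le_card_of_injOn (fun a => a • y) ?_ ?_
  · intro a ha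
    have ha0 : a ≠ 0 := Finset.ne_of_mem_erase ha
    refine Finset.mem_coe.2 (Finset.mem_filter.2 ⟨Finset.mem_erase.2
      ⟨smul_ne_zero ha0 hy, Finset.mem_univ _⟩, fun x hx => hyi x ?_⟩)
    simpa [ha0] using hx
  · intro a _ b _ hab
    exact smul_left_injective F hy hab

/-- Each of the `q ^ (K + 1) - 1` nonzero functionals has at most `σ = ⌈d / q ^ K⌉` coordinates
vanishing on its kernel. By `le_mul_residualSum` the total exceeds `σ - 1` per functional by at
least `q ^ (e + 1) - 1`, so at least that many attain `σ`. -/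
lemma RelGriesmer.exists_hyperplanes (h : RelGriesmer ev ⊥ s d) {K e : ℕ}
    (hK : finrank F V = K + 1) (he : e ≤ K) (hd : Fintype.card F ^ e ∣ d) :
    ∃ Z : Finset (V →ₗ[F] F), (∀ z ∈ Z, z ≠ 0 ∧
      (vanishing ev s z).card = d ⌈/⌉ Fintype.card F ^ K) ∧
      Fintype.card F ^ (e + 1) - 1 ≤ Z.card := by
  classical
  have hq : 0 < Fintype.card F := Fintype.card_pos
  have : Finite (V →ₗ[F] F) := Module.finite_of_finite F
  let _ : Fintype (V →ₗ[F] F) := Fintype.ofFinite _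
  have hcard : Fintype.card (V →ₗ[F] F) = Fintype.card F ^ (K + 1) := by
    have h2 : finrank F (Module.Dual F V) = finrank F V := Subspace.dual_finrank_eq
    rw [← hK, ← h2]; exact Module.card_eq_pow_finrank
  set σ := d ⌈/⌉ Fintype.card F ^ K with hσ
  refine ⟨(Finset.univ.erase 0).filter fun z => (vanishing ev s z).card = σ, fun z hz => ?_, ?_⟩
  · rw [Finset.mem_filter, Finset.mem_erase] at hz
    exact ⟨hz.1.1, hz.2⟩
  · have h1 := mul_card_le_sum_card_vanishing ev s (by omega)
    have h2 : ∀ z ∈ Finset.univ.erase (0 : V →ₗ[F] F), (vanishing ev s z).card ≤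
        (σ - 1) + if (vanishing ev s z).card = σ then 1 else 0 := by
      intro z hz
      have := h.card_vanishing_le hK (Finset.ne_of_mem_erase hz)
      split_ifs <;> omega
    have h3 := h1.trans (Finset.sum_le_sum h2)
    rw [Finset.sum_add_distrib, Finset.sum_const, ← Finset.card_filter,
      Finset.card_erase_of_mem (Finset.mem_univ _), Finset.card_univ, hcard, smul_eq_mul,
      h.card_eq, finrank_bot, Nat.sub_zero, hK] at h3
    have h4 := le_mul_residualSum hq h.pos hd he
    rw [← hσ, mul_comm (σ - 1), mul_comm (Fintype.card F - 1)] at h4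
    omega

end Hyperplanes

/-! ### The case `e ≥ 3`, `f ≥ 2`. -/

namespace GroupAlg

lemma lext_comp_subtype_eq_zero {F V : Type*} [Field F] [AddCommGroup V] [Module F V]
    {u : V → F} {N : ℕ} (hΛ : ∀ r ∈ augIdeal F V ^ N, lext u r = 0) (U : Submodule F V) :
    ∀ r ∈ augIdeal F U ^ N, lext (fun x : U => u x) r = 0 := fun r hr => by
  have := hΛ _ (push_mem_pow U.subtype.toAddMonoidHom hr)
  rwa [lext_push] at this

/-- Vanishing of a function of low degree on a Griesmer code of highly divisible minimum weight,
from its vanishing at the words of minimum weight. -/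
lemma eq_zero_of_min_weight_of_three_le {F : Type*} [Field F] [Fintype F] [DecidableEq F] {p : ℕ}
    [hp : Fact p.Prime] [CharP F p] {f e : ℕ} (hf : 2 ≤ f) (he : 3 ≤ e)
    (hq : Fintype.card F = p ^ f) {ι : Type*} (k : ℕ) {V : Type*} [AddCommGroup V] [Module F V]
    [Module.Finite F V] (hk : Module.finrank F V = k) {ev : ι → V →ₗ[F] F} {s : Finset ι} {d : ℕ}
    (h : RelGriesmer ev ⊥ s d) (hd : Fintype.card F ^ e ∣ d) {u : V → F}
    (hΛ : ∀ r ∈ augIdeal F V ^ ((e + f - 1) * (p - 1) + 1), lext u r = 0) (hu0 : u 0 = 0)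
    (hu : ∀ x, weight ev s x = d → u x = 0) : u = 0 := by
  classical
  induction k generalizing V s with
  | zero =>
    have := Module.finrank_zero_iff.1 hk
    funext x
    rw [Subsingleton.elim x 0]; exact hu0
  | succ K ih =>
    by_cases hKe : K ≤ e
    · funext x
      by_cases hx : x = 0
      · rw [hx]; exact hu0
      · exact hu x (h.weight_eq_of_finrank_le hd (by omega) hx)
    · obtain ⟨Z, hZ, hZc⟩ := h.exists_hyperplanes hk (by omega) hd
      have hker : ∀ z ∈ Z, ∀ x, z x = 0 → u x = 0 := by
        intro z hz x hx
        obtain ⟨hz0, hzc⟩ := hZ z hz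
        have h1 := ih (finrank_ker_of_ne_zero hz0 hk) (h.restrict_ker hk hz0 hzc)
          (lext_comp_subtype_eq_zero hΛ _) hu0 fun y hy => by
            rw [weight_ker] at hy
            exact hu y hy
        exact congrFun h1 (⟨x, hx⟩ : LinearMap.ker z)
      by_contra hne
      have : Finite V := Module.finite_of_finite F
      let _ : Fintype V := Fintype.ofFinite V
      -- The support of `u` avoids all kernels from `Z`, which bounds it above; the Reed-Muller
      -- bound gives the contradictory lower bound.
      set T := Finset.univ.filter fun x => u x ≠ 0 with hT
      have h1 := card_mul_card_le_of_forall_ne_zero Z (fun z hz => (hZ z hz).1) T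
        fun x hx z hz h0 => (Finset.mem_filter.1 hx).2 (hker z hz x h0)
      have h2 : Fintype.card V ≤ p ^ (e + f - 1) * T.card := by
        convert reedMuller (p := p) (fun g : V => ?_) u (e + f - 1) (degLT_of_lext _ u hΛ) hne
        rw [← Nat.cast_smul_eq_nsmul F, CharP.cast_eq_zero, zero_smul]
      have hTpos : 0 < T.card := by
        refine Finset.card_pos.2 ?_
        obtain ⟨x, hx⟩ := Function.ne_iff.1 hne
        exact ⟨x, Finset.mem_filter.2 ⟨Finset.mem_univ _, hx⟩⟩
      have h3 := sq_mul_pow_lt hp.out.two_le hq hf he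
      have h4 : T.card * (Fintype.card F ^ (e + 1) - 1) ≤
          T.card * ((Fintype.card F - 1) ^ 2 * p ^ (e + f - 1)) :=
        calc _ ≤ T.card * Z.card := Nat.mul_le_mul_left _ hZc
          _ ≤ _ := h1
          _ ≤ (Fintype.card F - 1) ^ 2 * (p ^ (e + f - 1) * T.card) := Nat.mul_le_mul_left _ h2
          _ = _ := by ring
      have h5 := Nat.le_of_mul_le_mul_left h4 hTpos
      omega

end GroupAlg

/-! ### Assembly: induction on `e`, and translation to codes. -/

open GroupAlg in
/-- Ward's divisibility for Griesmer codes over `F`, `|F| = p ^ f`. -/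
lemma RelGriesmer.pow_dvd_weight {F : Type*} [Field F] [Fintype F] [DecidableEq F] {p f : ℕ}
    [hp : Fact p.Prime] [CharP F p] (hf : 0 < f) (hq : Fintype.card F = p ^ f) {ι : Type*}
    {V : Type*} [AddCommGroup V] [Module F V] [Module.Finite F V] {ev : ι → V →ₗ[F] F}
    {s : Finset ι} {d : ℕ} (h : RelGriesmer ev ⊥ s d) (e : ℕ) (hd : Fintype.card F ^ e ∣ d)
    (x : V) : p ^ e ∣ weight ev s x := by
  induction e generalizing x with
  | zero => simp
  | succ e ih =>
    have hppos : 0 < p ^ e := pow_pos hp.out.pos e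
    choose U hU using ih ((pow_dvd_pow _ (Nat.le_succ e)).trans hd)
    have hscal : ∀ (a : Fˣ) y, U ((a : F) • y) = U y := fun a y =>
      Nat.eq_of_mul_eq_mul_left hppos (by rw [← hU, ← hU, weight_smul ev s a.ne_zero])
    have hzero : U 0 = 0 := by
      have h1 := hU 0
      rw [show weight ev s 0 = 0 by simp [weight]] at h1
      exact (Nat.mul_eq_zero.1 h1.symm).resolve_left hppos.ne'
    have hmin : ∀ y, weight ev s y = d → ((U y : ℤ) : F) = 0 := by
      intro y hy
      -- `p ∣ q`, so `d / p ^ e` is still a multiple of `p`.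
      have h1 : p ^ (e + 1) ∣ d :=
        (pow_dvd_pow_of_dvd (hq ▸ dvd_pow_self p hf.ne') (e + 1)).trans hd
      rw [← hy, hU, pow_succ] at h1
      rw [Int.cast_natCast, CharP.cast_eq_zero_iff F p]
      exact Nat.dvd_of_mul_dvd_mul_left hppos h1
    have hΛ : ∀ r ∈ augIdeal F V ^ ((e + 1 + f - 1) * (p - 1) + 1),
        lext (fun y => ((U y : ℤ) : F)) r = 0 := by
      refine lext_cast_eq_zero_of_dvd (p := p) (c := (p : ℤ) ^ e)
        (pow_ne_zero _ (by exact_mod_cast hp.out.ne_zero)) (fun y => (U y : ℤ)) _ fun r hr => ?_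
      have h1 := dvd_lext_sum_comp s p f hp.out
        (fun g : F => by rw [← Nat.cast_smul_eq_nsmul F, CharP.cast_eq_zero, zero_smul])
        (by rw [Nat.card_eq_fintype_card, hq]) (fun a : F => if a ≠ 0 then (1 : ℤ) else 0)
        (fun i => (ev i).toAddMonoidHom) (e + 1) _ ?_ r hr
      · rw [pow_succ] at h1
        convert h1 using 3
        funext y
        have h2 := congrArg (Nat.cast : ℕ → ℤ) (hU y)
        push_cast at h2
        rw [← h2, weight, Finset.card_filter]
        push_cast
        rfl
      · rw [show e + 1 + f - 1 = e + f by omega, show e + 1 + f = e + f + 1 by ring, add_mul]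
        omega
    have hzero' : (fun y => ((U y : ℤ) : F)) = 0 := by
      by_cases hef : e + 1 ≤ 2 ∨ f = 1
      · exact eq_zero_of_min_weight p hf (Nat.succ_pos e) hef hq _
          (fun a y => by rw [hscal]) hΛ s d h hd (by rw [hzero]; simp) hmin
      · push Not at hef
        exact eq_zero_of_min_weight_of_three_le (by omega) (by omega) hq _ rfl h hd hΛ
          (by rw [hzero]; simp) hmin
    have h1 := congrFun hzero' x
    simp only [Int.cast_natCast, Pi.zero_apply] at h1
    rw [hU, pow_succ]
    exact Nat.mul_dvd_mul_left _ ((CharP.cast_eq_zero_iff F p _).1 h1)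

lemma IsGriesmerCode.relGriesmer {F : Type*} [Field F] [Fintype F] [DecidableEq F] {n k d : ℕ}
    {C : Submodule F (Fin n → F)} (hC : IsGriesmerCode C k d) :
    RelGriesmer (fun i => (LinearMap.proj i).comp C.subtype) ⊥ (Finset.univ : Finset (Fin n)) d := by
  refine ⟨?_, ?_, ?_, ?_⟩
  · obtain ⟨c, -, hc0, hc⟩ := hC.minWeight.1
    rw [← hc]
    exact hammingNorm_pos_iff.2 hc0
  · intro i _ x hx
    rw [(Submodule.mem_bot F).1 hx, map_zero]
  · intro x hx
    exact hC.minWeight.2 ⟨x, x.2, by simpa using hx, rfl⟩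
  · rw [finrank_bot, Nat.sub_zero, hC.finrank_eq, Finset.card_fin, hC.length_eq,
      griesmerNumber_eq _ _ _ Fintype.card_pos]

theorem theorem1p6 {F : Type*} [Field F] [Fintype F] [DecidableEq F]
    (p f q : ℕ) (hp : p.Prime) (hq : q = p ^ f) (hF : Fintype.card F = q)
    (n k d : ℕ) (C : Submodule F (Fin n → F)) (hC : IsGriesmerCode C k d) :
    (∀ e : ℕ, q ^ e ∣ d → ∀ c ∈ C, p ^ e ∣ hammingNorm c) ∧
    (∀ e : ℕ, p ^ e ∣ d → ∀ c ∈ C, p ^ (e / f) ∣ hammingNorm c) := by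
  have : Fact p.Prime := ⟨hp⟩
  have hcard : Fintype.card F = p ^ f := hF.trans hq
  have : CharP F p := charP_of_card_eq_prime_pow hcard
  have hf : 0 < f := by
    by_contra h0
    have := Fintype.one_lt_card (α := F)
    rw [hcard, Nat.eq_zero_of_not_pos h0, pow_zero] at this
    exact lt_irrefl 1 this
  have key : ∀ e : ℕ, q ^ e ∣ d → ∀ c ∈ C, p ^ e ∣ hammingNorm c := fun e he c hc =>
    hC.relGriesmer.pow_dvd_weight hf hcard e (hF ▸ he) ⟨c, hc⟩
  refine ⟨key, fun e he c hc => key (e / f) ?_ c hc⟩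
  -- `q ^ (e / f) = p ^ (f * (e / f))`, and `f * (e / f) ≤ e`.
  rw [hq, ← pow_mul]
  exact (pow_dvd_pow p (Nat.mul_div_le e f)).trans he
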